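/- Let $d,k\ge 1$ be fixed integers. All digraphs are finite, without loops or parallel edges (but for distinct vertices $u,v$ both $uv$ and $vu$ may be edges). A path of a digraph $G$ is a directed path; it has at least one vertex. A path $P$ of $G$ with vertices $v_1,\ldots,v_m$ in order is minimal if $j\le i+1$ for every edge $v_iv_j$ of $G$ with $1\le i,j\le m$. The digraph $G$ is $d$-path-dominant if for every minimal path $P$ of $G$ with exactly $d$ vertices, every vertex of $G$ belongs to $P$, or has an out-neighbour in $P$, or has an in-neighbour in $P$. Theorem. For all fixed integers $d,k\ge 1$, the $k$ vertex-disjoint directed paths problem is solvable in polynomial time on $d$-path-dominant digraphs. That is, there are an algorithm and a polynomial $f$ (both depending only on $d$ and $k$) such that for every $d$-path-dominant digraph $G$ with $n$ vertices and all (not necessarily distinct) vertices $s_1,t_1,\ldots,s_k,t_k$ of $G$, the algorithm with input $(G,s_1,t_1,\ldots,s_k,t_k)$ halts after at most $f(n)$ steps and decides correctly whether there exist pairwise vertex-disjoint paths $P_1,\ldots,P_k$ of $G$ such that $P_i$ is from $s_i$ to $t_i$ for $1\le i\le k$. Here an algorithm is a program for a random access machine with registers and arrays of natural numbers, unit-cost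 addition, truncated subtraction, tests for zero and indirect addressing (no multiplication); $G$ is given by its number of vertices and its adjacency matrix. -/

import Mathlib

namespace DisjointPaths

/-! ### Directed paths in digraphs -/

/-- `IsPath G P`: the list `P` is the vertex sequence `v₁, …, vₘ` (in order, `m ≥ 1`) of a directed
path of `G`; the vertices are distinct and each one is adjacent to the next one. -/
def IsPath {V : Type*} (G : Digraph V) (P : List V) : Prop :=
  P ≠ [] ∧ P.Nodup ∧ P.IsChain G.Adj

/-- A path with vertices `v₁, …, vₘ` in order is minimal if `j ≤ i + 1` for every edge `vᵢvⱼ`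
of `G`. -/
def IsMinimalPath {V : Type*} (G : Digraph V) (P : List V) : Prop :=
  IsPath G P ∧ ∀ i j : Fin P.length, G.Adj (P.get i) (P.get j) → (j : ℕ) ≤ i + 1

/-- `G` is `d`-path-dominant: for every minimal path `P` with `d` vertices, every vertex of `G`
belongs to `P`, or has an out-neighbour in `P`, or has an in-neighbour in `P`. -/
def IsPathDominant {V : Type*} (d : ℕ) (G : Digraph V) : Prop :=
  ∀ P : List V, IsMinimalPath G P → P.length = d →
    ∀ v : V, v ∈ P ∨ (∃ u ∈ P, G.Adj v u) ∨ (∃ u ∈ P, G.Adj u v)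

/-- There are pairwise vertex-disjoint directed paths `P₁, …, Pₖ` of `G` such that `Pᵢ` is from
`sᵢ` to `tᵢ`. -/
def HasLinkage {V : Type*} {k : ℕ} (G : Digraph V) (s t : Fin k → V) : Prop :=
  ∃ P : Fin k → List V,
    (∀ i, IsPath G (P i) ∧ (P i).head? = some (s i) ∧ (P i).getLast? = some (t i)) ∧
    ∀ i j, i ≠ j → List.Disjoint (P i) (P j)

/-! ### Random access machines

Structured programs for a random access machine. The machine has registers holding natural numbers
and arrays of natural numbers; a program is a finite object and so uses only finitely many of the
registers and arrays. The arithmetic is addition and truncated subtraction (no multiplication, so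
that unit cost is polynomially related to the time of Turing machines), and array cells are
addressed indirectly. -/

/-- Expressions: constants, register contents, array cells, sums, truncated differences. -/
inductive Expr : Type
  | const (c : ℕ) : Expr
  | reg (x : ℕ) : Expr
  | read (a : ℕ) (i : Expr) : Expr
  | plus (e₁ e₂ : Expr) : Expr
  | minus (e₁ e₂ : Expr) : Expr

/-- Programs: no operation, assignment to a register, assignment to the cell `i` of the array `a`,
sequential composition, branching and looping; a test succeeds if its value is nonzero. -/
inductive Program : Type
  | skip : Program
  | assign (x : ℕ) (e : Expr) : Program
  | store (a : ℕ) (i e : Expr) : Program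
  | seq (p q : Program) : Program
  | branch (e : Expr) (p q : Program) : Program
  | loop (e : Expr) (p : Program) : Program

/-- The memory: `reg x` is the content of register `x`, and `arr a i` that of cell `i` of
array `a`. -/
@[ext]
structure Memory : Type where
  reg : ℕ → ℕ
  arr : ℕ → ℕ → ℕ

/-- The value of an expression. -/
def Expr.eval (m : Memory) : Expr → ℕ
  | .const c => c
  | .reg x => m.reg x
  | .read a i => m.arr a (i.eval m)
  | .plus e₁ e₂ => e₁.eval m + e₂.eval m
  | .minus e₁ e₂ => e₁.eval m - e₂.eval m

/-- The number of steps for evaluating an expression: one for each of its nodes. -/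
def Expr.cost : Expr → ℕ
  | .const _ => 1
  | .reg _ => 1
  | .read _ i => i.cost + 1
  | .plus e₁ e₂ => e₁.cost + e₂.cost + 1
  | .minus e₁ e₂ => e₁.cost + e₂.cost + 1

/-- Write `v` into register `x`. -/
def Memory.setReg (m : Memory) (x v : ℕ) : Memory :=
  { m with reg := Function.update m.reg x v }

/-- Write `v` into cell `i` of array `a`. -/
def Memory.setArr (m : Memory) (a i v : ℕ) : Memory :=
  { m with arr := Function.update m.arr a (Function.update (m.arr a) i v) }

/-- `Runs p m m' T`: started with memory `m`, the program `p` halts after exactly `T` steps, with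
memory `m'`. -/
inductive Runs : Program → Memory → Memory → ℕ → Prop
  | skip (m : Memory) : Runs .skip m m 1
  | assign (x : ℕ) (e : Expr) (m : Memory) :
      Runs (.assign x e) m (m.setReg x (e.eval m)) (e.cost + 1)
  | store (a : ℕ) (i e : Expr) (m : Memory) :
      Runs (.store a i e) m (m.setArr a (i.eval m) (e.eval m)) (i.cost + e.cost + 1)
  | seq {p q : Program} {m m' m'' : Memory} {T T' : ℕ} :
      Runs p m m' T → Runs q m' m'' T' → Runs (.seq p q) m m'' (T + T')
  | branch_true {e : Expr} {p q : Program} {m m' : Memory} {T : ℕ} :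
      e.eval m ≠ 0 → Runs p m m' T → Runs (.branch e p q) m m' (e.cost + 1 + T)
  | branch_false {e : Expr} {p q : Program} {m m' : Memory} {T : ℕ} :
      e.eval m = 0 → Runs q m m' T → Runs (.branch e p q) m m' (e.cost + 1 + T)
  | loop_stop {e : Expr} {p : Program} {m : Memory} :
      e.eval m = 0 → Runs (.loop e p) m m (e.cost + 1)
  | loop_step {e : Expr} {p : Program} {m m' m'' : Memory} {T T' : ℕ} :
      e.eval m ≠ 0 → Runs p m m' T → Runs (.loop e p) m' m'' T' →
        Runs (.loop e p) m m'' (e.cost + 1 + T + T')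

open Classical in
/-- The input `(G, s₁, t₁, …, sₖ, tₖ)`, where `G` has vertices `0, …, n - 1`: register `0` holds
`n`; array `0` holds the adjacency matrix of `G` row by row (cell `u * n + v` is `1` if `uv` is an
edge); arrays `1` and `2` hold `s₁, …, sₖ` and `t₁, …, tₖ`; everything else is `0`. -/
noncomputable def inputMemory {n k : ℕ} (G : Digraph (Fin n)) (s t : Fin k → Fin n) : Memory where
  reg x := if x = 0 then n else 0
  arr a c :=
    if a = 0 then (if ∃ u v : Fin n, c = u * n + v ∧ G.Adj u v then 1 else 0)
    else if a = 1 then (if h : c < k then (s ⟨c, h⟩ : ℕ) else 0)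
    else if a = 2 then (if h : c < k then (t ⟨c, h⟩ : ℕ) else 0)
    else 0

/-- The `k` vertex-disjoint (directed) paths problem is solvable in polynomial time on the class `C`
of finite digraphs: some program and some polynomial `f` have the property that on each input
`(G, s₁, t₁, …, sₖ, tₖ)`, with `G` in `C` and loopless with `n` vertices, the program halts after at
most `f n` steps and register `0` then holds the right answer, `1` for yes and `0` for no. -/
def DisjointPathsInPolyTime (k : ℕ) (C : ∀ n : ℕ, Digraph (Fin n) → Prop) : Prop :=
  ∃ (p : Program) (f : Polynomial ℕ),
    ∀ (n : ℕ) (G : Digraph (Fin n)), (∀ v, ¬ G.Adj v v) → C n G →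
      ∀ s t : Fin k → Fin n, ∃ (m : Memory) (T : ℕ),
        Runs p (inputMemory G s t) m T ∧ T ≤ f.eval n ∧
        (HasLinkage G s t → m.reg 0 = 1) ∧ (¬ HasLinkage G s t → m.reg 0 = 0)

end DisjointPaths

/-! Consider a linkage with as few vertices as possible. No edge jumps forward along one of its
paths by more than one position, so the paths are minimal and every window of `d` consecutive
vertices dominates. Consequently a vertex sends an edge back into every earlier `d`-window of its
path that does not end immediately before it (`exists_adj_window_back`).

Now traverse all paths simultaneously, one vertex at a time. A clash consists of `m` traversed
vertices of one path, all adjacent to the same `m` vertices ahead on a path. For suitable `m`,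
depending only on `d` and `k`, some unfinished path can always be advanced without creating a clash
(`exists_clash_bound`). Otherwise advancing any unfinished path `p` creates a clash from `p` to some
unfinished path `f p`, and `f` has a cycle. Each path on it can jump ahead to the next path, fall
back into the traversed part, jump again, and return home after `N` jumps. These reroutings are
disjoint, use only old vertices and omit one of them, against minimality (`no_cyclic_detour`).

The traversal can be followed with bounded memory: the `k` ends, the last `c` vertices of each path,
and at most `M` exceptional vertices, which are those ahead with many in-neighbours in some window.
Absence of clashes bounds their number by pigeonhole (`card_exceptional_le`). These data determine
the safe vertices. Everything ahead is safe; nothing traversed is, since a forgotten vertex receives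
edges from many later `d`-windows. The linkage thus becomes a walk in the state graph
(`step_stateOf`). Conversely, in any digraph, a walk of states gives disjoint paths: each new vertex
was safe, is unsafe afterwards, and no vertex ever becomes safe again (`Good.step`).

With `K = k + k * c + M` fixed there are `(n + 1) ^ K` states, and walks of length at most `n`
suffice. A search by repeated relaxation of all pairs of states therefore takes polynomial time. -/

namespace DisjointPaths

/-! ### Shortest linkages and domination by windows -/

section Reach

variable {V : Type*} {k : ℕ}

/-- `b` can be reached from `a` by a walk all of whose vertices are in `U`. -/
def ReachIn (G : Digraph V) (U : Set V) (a b : V) : Prop :=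
  a ∈ U ∧ Relation.ReflTransGen (fun x y => G.Adj x y ∧ y ∈ U) a b

theorem ReachIn.exists_path {G : Digraph V} {U : Set V} {a b : V} (h : ReachIn G U a b) :
    ∃ P : List V, IsPath G P ∧ P.head? = some a ∧ P.getLast? = some b ∧ ∀ x ∈ P, x ∈ U := by
  obtain ⟨ha, h⟩ := h
  induction h using Relation.ReflTransGen.head_induction_on with
  | refl => exact ⟨[b], ⟨by simp, by simp, by simp⟩, by simp, by simp, by simpa using ha⟩
  | head hac _ ih =>
    rename_i a c hcb
    obtain ⟨P, ⟨hne, hnd, hch⟩, hh, hl, hU⟩ := ih hac.2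
    -- If the walk returns to `a`, the part of `P` before that visit is discarded.
    by_cases haP : a ∈ P
    · obtain ⟨l₁, l₂, rfl⟩ := List.append_of_mem haP
      refine ⟨a :: l₂, ⟨by simp, ?_, ?_⟩, by simp, ?_, fun x hx => hU x (by simp_all)⟩
      · exact (List.nodup_append.1 hnd).2.1
      · exact (List.isChain_append.1 hch).2.1
      · simpa [List.getLast?_append] using hl
    · refine ⟨a :: P, ⟨by simp, by simp [haP, hnd], ?_⟩, by simp, ?_, ?_⟩
      · rw [List.isChain_cons]
        refine ⟨fun y hy => ?_, hch⟩
        rw [hh] at hy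
        obtain rfl : c = y := by simpa using hy
        exact hac.1
      · rw [List.getLast?_cons, hl]; simp
      · exact List.forall_mem_cons.2 ⟨ha, hU⟩

theorem hasLinkage_of_reachIn {G : Digraph V} {s t : Fin k → V} {W : Fin k → Set V}
    (hW : ∀ p q, p ≠ q → Disjoint (W p) (W q)) (h : ∀ p, ReachIn G (W p) (s p) (t p)) :
    HasLinkage G s t := by
  choose P h₁ h₂ h₃ h₄ using fun p => (h p).exists_path
  refine ⟨P, fun i => ⟨h₁ i, h₂ i, h₃ i⟩, fun i j hij x hi hj => ?_⟩
  exact Set.disjoint_left.1 (hW i j hij) (h₄ i x hi) (h₄ j x hj)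

/-- `v p 0, …, v p (len p - 1)` are the vertices of the `p`-th path of a linkage with the least
possible number of vertices. -/
structure ShortestLinkage (G : Digraph V) (s t : Fin k → V) (len : Fin k → ℕ)
    (v : Fin k → ℕ → V) : Prop where
  pos : ∀ p, 0 < len p
  inj : ∀ {p q i j}, i < len p → j < len q → v p i = v q j → p = q ∧ i = j
  adj : ∀ {p i}, i + 1 < len p → G.Adj (v p i) (v p (i + 1))
  source : ∀ p, v p 0 = s p
  target : ∀ p, v p (len p - 1) = t p
  shortest : ∀ W : Fin k → Set V, (∀ p q, p ≠ q → Disjoint (W p) (W q)) →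
    (∀ p, ReachIn G (W p) (s p) (t p)) → ∑ p, len p ≤ (⋃ p, W p).ncard

/-- Minimality is stated against disjoint vertex sets joining the terminals rather than against
lists of paths, so that a rerouting can later be given by the set of vertices it uses, with walks in
place of paths. -/
theorem exists_shortestLinkage [Finite V] {G : Digraph V} {s t : Fin k → V}
    (h : HasLinkage G s t) : ∃ len v, ShortestLinkage G s t len v := by
  classical
  let good : (Fin k → List V) → Prop := fun P =>
    (∀ i, IsPath G (P i) ∧ (P i).head? = some (s i) ∧ (P i).getLast? = some (t i)) ∧
      ∀ i j, i ≠ j → List.Disjoint (P i) (P j)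
  have hex : ∃ N, ∃ P, good P ∧ ∑ p, (P p).length = N := by
    obtain ⟨P, hP⟩ := h
    exact ⟨_, P, hP, rfl⟩
  obtain ⟨P, ⟨hP, hdis⟩, hN⟩ := Nat.find_spec hex
  have hget : ∀ p i (hi : i < (P p).length), (P p).getD i (s p) = (P p)[i] := fun p i hi => by
    simp [hi]
  refine ⟨fun p => (P p).length, fun p i => (P p).getD i (s p), ?_, ?_, ?_, ?_, ?_, ?_⟩
  · exact fun p => List.length_pos_iff.2 (hP p).1.1
  · intro p q i j hi hj hij
    rw [hget p i hi, hget q j hj] at hij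
    by_cases hpq : p = q
    · subst hpq
      exact ⟨rfl, (hP p).1.2.1.getElem_inj_iff.1 hij⟩
    · exact absurd (List.getElem_mem hj) (hij ▸ hdis p q hpq (List.getElem_mem hi))
  · intro p i hi
    rw [hget p i (by omega), hget p (i + 1) hi]
    exact List.isChain_iff_getElem.1 (hP p).1.2.2 i hi
  · intro p
    have := (hP p).2.1
    rw [List.head?_eq_getElem?] at this
    simp [this]
  · intro p
    have := (hP p).2.2
    rw [List.getLast?_eq_getElem?] at this
    simp [this]
  · intro W hW hr
    choose P' h₁ h₂ h₃ h₄ using fun p => (hr p).exists_path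
    have hd' : ∀ i j, i ≠ j → List.Disjoint (P' i) (P' j) := fun i j hij x hi hj =>
      Set.disjoint_left.1 (hW i j hij) (h₄ i x hi) (h₄ j x hj)
    have hmin := Nat.find_min' hex ⟨P', ⟨fun i => ⟨h₁ i, h₂ i, h₃ i⟩, hd'⟩, rfl⟩
    rw [← hN] at hmin
    refine hmin.trans ?_
    have hcard : (Finset.univ.biUnion fun p => (P' p).toFinset).card = ∑ p, (P' p).length := by
      rw [Finset.card_biUnion]
      · exact Finset.sum_congr rfl fun p _ => List.toFinset_card_of_nodup (h₁ p).2.1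
      · intro i _ j _ hij
        refine Finset.disjoint_left.2 fun x hi hj => ?_
        exact hd' i j hij (by simpa using hi) (by simpa using hj)
    rw [← hcard, ← Set.ncard_coe_finset]
    refine Set.ncard_le_ncard ?_ (Set.toFinite _)
    intro x hx
    simp only [Finset.coe_biUnion, Set.mem_iUnion] at hx ⊢
    obtain ⟨p, -, hp⟩ := hx
    exact ⟨p, h₄ p x (by simpa using hp)⟩

namespace ShortestLinkage

variable {G : Digraph V} {s t : Fin k → V} {len : Fin k → ℕ} {v : Fin k → ℕ → V}

theorem reach_segment (H : ShortestLinkage G s t len v) {U : Set V} {p : Fin k} {i j : ℕ}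
    (hij : i ≤ j) (hj : j < len p) (hU : ∀ l, i < l → l ≤ j → v p l ∈ U) :
    Relation.ReflTransGen (fun x y => G.Adj x y ∧ y ∈ U) (v p i) (v p j) := by
  induction j, hij using Nat.le_induction with
  | base => exact .refl
  | succ j hij ih =>
    exact (ih (by omega) fun l h₁ h₂ => hU l h₁ (by omega)).tail
      ⟨H.adj hj, hU _ (by omega) le_rfl⟩

/-- The form in which minimality is applied: a rerouting that gives up the positions `R` of path `q`
and otherwise adds only vertices of `Z` cannot give up more than it adds. -/
theorem card_le_of_avoid [Finite V] (H : ShortestLinkage G s t len v) {W : Fin k → Set V}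
    (hW : ∀ p q, p ≠ q → Disjoint (W p) (W q)) (hr : ∀ p, ReachIn G (W p) (s p) (t p))
    (q : Fin k) (R : Finset ℕ) (hR : ∀ l ∈ R, l < len q) (Z : Set V)
    (hsub : ∀ p, ∀ x ∈ W p, x ∈ Z ∨ ∃ p' l, l < len p' ∧ x = v p' l ∧ (p' = q → l ∉ R)) :
    R.card ≤ Z.ncard := by
  classical
  let I : Finset (Σ _ : Fin k, ℕ) := Finset.univ.sigma fun p => Finset.range (len p)
  let D : Finset (Σ _ : Fin k, ℕ) := R.image fun l => ⟨q, l⟩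
  have hI : I.card = ∑ p, len p := by simp [I]
  have hD : D.card = R.card :=
    Finset.card_image_of_injective _ fun a b h => by simpa using h
  have hDI : D ⊆ I := by
    intro x hx
    obtain ⟨l, hl, rfl⟩ := Finset.mem_image.1 hx
    simpa [I] using hR l hl
  have h₁ := H.shortest W hW hr
  have h₂ : (⋃ p, W p) ⊆ ((I \ D).image fun x => v x.1 x.2 : Finset V) ∪ Z := by
    intro x hx
    obtain ⟨p, hp⟩ := Set.mem_iUnion.1 hx
    rcases hsub p x hp with h | ⟨p', l, hl, rfl, hne⟩
    · exact Or.inr h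
    · refine Or.inl (Finset.mem_coe.2 (Finset.mem_image.2 ⟨⟨p', l⟩, ?_, rfl⟩))
      simp only [Finset.mem_sdiff, Finset.mem_sigma, Finset.mem_univ, true_and, Finset.mem_range,
        hl, Finset.mem_image, not_exists, not_and, I, D]
      rintro l' hl' h
      simp only [Sigma.mk.injEq, heq_eq_eq] at h
      obtain ⟨rfl, h⟩ := h
      obtain rfl : l' = l := by simpa using h
      exact hne rfl hl'
  have h₃ := (Set.ncard_le_ncard h₂ (Set.toFinite _)).trans (Set.ncard_union_le _ _)
  rw [Set.ncard_coe_finset] at h₃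
  have h₄ := Finset.card_image_le (s := I \ D) (f := fun x => v x.1 x.2)
  rw [Finset.card_sdiff_of_subset hDI] at h₄
  have h₅ := Finset.card_le_card hDI
  omega

/-- Leaving a path and coming back to it later over new vertices saves nothing. -/
theorem le_of_detour [Finite V] (H : ShortestLinkage G s t len v) {p : Fin k} {i j : ℕ}
    (hij : i < j) (hj : j < len p) (Z : Set V) (hZ : ∀ q l, l < len q → v q l ∉ Z)
    (hr : Relation.ReflTransGen (fun x y => G.Adj x y ∧ y ∈ insert (v p j) Z) (v p i) (v p j)) :
    j ≤ i + 1 + Z.ncard := by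
  classical
  let W : Fin k → Set V := fun q =>
    if q = p then {x | ∃ l, l < len p ∧ (l ≤ i ∨ j ≤ l) ∧ x = v p l} ∪ Z
    else {x | ∃ l, l < len q ∧ x = v q l}
  have hsub : ∀ q, ∀ x ∈ W q, x ∈ Z ∧ q = p ∨
      ∃ l, l < len q ∧ x = v q l ∧ (q = p → (l ≤ i ∨ j ≤ l)) := by
    intro q x hx
    by_cases hq : q = p
    · subst hq
      simp only [W, if_true] at hx
      rcases hx with ⟨l, h₁, h₂, h₃⟩ | hx
      · exact Or.inr ⟨l, h₁, h₃, fun _ => h₂⟩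
      · exact Or.inl ⟨hx, rfl⟩
    · simp only [W, if_neg hq] at hx
      obtain ⟨l, h₁, h₂⟩ := hx
      exact Or.inr ⟨l, h₁, h₂, fun h => absurd h hq⟩
  have hWp : ∀ l, l < len p → (l ≤ i ∨ j ≤ l) → v p l ∈ W p := fun l h₁ h₂ => by
    simp only [W, if_true]; exact Or.inl ⟨l, h₁, h₂, rfl⟩
  have hWq : ∀ q ≠ p, ∀ l, l < len q → v q l ∈ W q := fun q hq l h₁ => by
    simp only [W, if_neg hq]; exact ⟨l, h₁, rfl⟩
  have h := H.card_le_of_avoid (W := W) ?_ ?_ p (Finset.Ioo i j)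
    (fun l hl => (Finset.mem_Ioo.1 hl).2.trans hj) Z ?_
  · simp at h; omega
  · intro q q' hqq
    rw [Set.disjoint_left]
    intro x hx hx'
    rcases hsub q x hx with ⟨hz, hq⟩ | ⟨l, hl, rfl, -⟩ <;>
      rcases hsub q' _ hx' with ⟨hz', hq'⟩ | ⟨l', hl', he, -⟩
    · exact hqq (hq.trans hq'.symm)
    · subst he; exact hZ _ _ hl' hz
    · exact hZ _ _ hl hz'
    · exact hqq (H.inj hl hl' he).1
  · intro q
    rw [← H.source, ← H.target]
    have hq := H.pos q
    by_cases hqp : q = p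
    · subst hqp
      refine ⟨hWp 0 hq (by omega), ?_⟩
      refine (H.reach_segment (j := i) (by omega) (by omega) fun l _ h => hWp l (by omega)
        (by omega)).trans (Relation.ReflTransGen.trans (b := v q j) ?_ ?_)
      · refine Relation.ReflTransGen.lift id ?_ _ _ hr
        rintro x y ⟨h₁, rfl | h₂⟩
        · exact ⟨h₁, hWp j hj (by omega)⟩
        · refine ⟨h₁, ?_⟩
          simp only [W, if_true]; exact Or.inr h₂
      · exact H.reach_segment (by omega) (by omega) fun l _ h => hWp l (by omega) (by omega)
    · exact ⟨hWq q hqp 0 hq, H.reach_segment (by omega) (by omega) fun l _ h =>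
        hWq q hqp l (by omega)⟩
  · intro q x hx
    rcases hsub q x hx with ⟨hz, hq⟩ | ⟨l, hl, rfl, h⟩
    · exact Or.inl hz
    · refine Or.inr ⟨q, l, hl, rfl, fun hqp => ?_⟩
      have := h hqp
      simp; omega

/-- A detour without new vertices. This makes the paths of a shortest linkage minimal, so that
dominance applies to them. -/
theorem le_succ_of_adj [Finite V] (H : ShortestLinkage G s t len v) {p : Fin k} {i j : ℕ}
    (hj : j < len p) (h : G.Adj (v p i) (v p j)) : j ≤ i + 1 := by
  by_contra! hij
  have := H.le_of_detour (i := i) (by omega) hj ∅ (by simp) (.single ⟨h, by simp⟩)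
  simp at this
  omega

theorem le_add_two_of_adj [Finite V] (H : ShortestLinkage G s t len v) {p : Fin k} {i j : ℕ}
    {z : V} (hj : j < len p) (hz : ∀ q l, l < len q → v q l ≠ z) (h₁ : G.Adj (v p i) z)
    (h₂ : G.Adj z (v p j)) : j ≤ i + 2 := by
  by_contra! hij
  have := H.le_of_detour (i := i) (by omega) hj {z} (by simpa using hz)
    (.tail (.single ⟨h₁, by simp⟩) ⟨h₂, by simp⟩)
  simp at this
  omega

/-- Every window of `d` consecutive vertices of a path dominates. -/
theorem exists_adj_window [Finite V] {d : ℕ} (hd : 1 ≤ d) (H : ShortestLinkage G s t len v)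
    (hG : IsPathDominant d G) {p : Fin k} {i : ℕ} (hi : i + d ≤ len p) {z : V}
    (hz : ∀ l, i ≤ l → l < i + d → v p l ≠ z) :
    ∃ l, i ≤ l ∧ l < i + d ∧ (G.Adj z (v p l) ∨ G.Adj (v p l) z) := by
  have hmem : ∀ x, x ∈ (List.range d).map (fun l => v p (i + l)) ↔ ∃ l < d, v p (i + l) = x := by
    simp
  have := hG ((List.range d).map fun l => v p (i + l)) ⟨⟨?_, ?_, ?_⟩, ?_⟩ (by simp) z
  · simp only [hmem] at this
    rcases this with ⟨l, hl, h⟩ | ⟨_, ⟨l, hl, rfl⟩, h⟩ | ⟨_, ⟨l, hl, rfl⟩, h⟩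
    · exact absurd h (hz _ (by omega) (by omega))
    · exact ⟨i + l, by omega, by omega, Or.inl h⟩
    · exact ⟨i + l, by omega, by omega, Or.inr h⟩
  · simp; omega
  · refine List.Nodup.map_on ?_ List.nodup_range
    intro a ha b hb hab
    rw [List.mem_range] at ha hb
    have := (H.inj (by omega) (by omega) hab).2
    omega
  · rw [List.isChain_iff_getElem]
    intro l hl
    simp only [List.length_map, List.length_range] at hl
    simp only [List.getElem_map, List.getElem_range]
    exact H.adj (by omega)
  · intro a b hab
    have ha := a.2
    have hb := b.2
    simp only [List.length_map, List.length_range] at ha hb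
    simp only [List.get_eq_getElem, List.getElem_map, List.getElem_range] at hab
    have := H.le_succ_of_adj (by omega) hab
    omega

/-- The window dominates `v p j`, and an edge from the window to `v p j` would jump forward by at
least two positions. -/
theorem exists_adj_window_back [Finite V] {d : ℕ} (hd : 1 ≤ d) (H : ShortestLinkage G s t len v)
    (hG : IsPathDominant d G) {p : Fin k} {i j : ℕ} (hi : i + d < j) (hj : j < len p) :
    ∃ l, i ≤ l ∧ l < i + d ∧ G.Adj (v p j) (v p l) := by
  obtain ⟨l, h₁, h₂, h | h⟩ := H.exists_adj_window hd hG (z := v p j) (p := p) (i := i) (by omega)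
    (fun l h₁ h₂ h => by have := (H.inj (show l < len p by omega) hj h).2; omega)
  · exact ⟨l, h₁, h₂, h⟩
  · have := H.le_succ_of_adj hj h
    omega

end ShortestLinkage

end Reach

/-! ### Traversing a shortest linkage without clashes -/

section TimeOrder

variable {V : Type*} {k : ℕ}

/-- The new path `p` follows its old course up to `x p 0` and jumps to position `y _ 1` of path `f
p`. There it returns by a backward edge into the `d` vertices ending at `x _ 1`, walks to `x _ 1`,
jumps to position `y _ 2` of the next path, and so on. The `N`-th jump lands at `y p N` on `p`
itself, whose old course is followed to the end. The spacing of the `x`, and the `y` lying beyond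
all of them, keep these routes disjoint. -/
theorem ShortestLinkage.no_cyclic_detour [Finite V] {G : Digraph V} {s t : Fin k → V}
    {len : Fin k → ℕ} {v : Fin k → ℕ → V} {d : ℕ} (hd : 1 ≤ d) (H : ShortestLinkage G s t len v)
    (hG : IsPathDominant d G) (f : Fin k → Fin k) {N : ℕ} (hN : 1 ≤ N) (C : Set (Fin k))
    (hne : C.Nonempty) (hf : ∀ p ∈ C, f p ∈ C) (hfN : ∀ p ∈ C, f^[N] p = p)
    (x y : Fin k → ℕ → ℕ) (hx : ∀ p ∈ C, ∀ i j, i < j → j < N → x p i + d ≤ x p j)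
    (hxy : ∀ p ∈ C, ∀ i j, i < N → 1 ≤ j → j ≤ N → x p i + 1 < y p j)
    (hy : ∀ p ∈ C, ∀ i j, 1 ≤ i → i < j → j ≤ N → y p i < y p j)
    (hyl : ∀ p ∈ C, y p N < len p)
    (hadj : ∀ p ∈ C, ∀ j < N, G.Adj (v p (x p j)) (v (f p) (y (f p) (j + 1)))) : False := by
  classical
  have hfi : ∀ j, ∀ p ∈ C, f^[j] p ∈ C := by
    intro j
    induction j with
    | zero => exact fun p hp => hp
    | succ j ih => exact fun p hp => by rw [Function.iterate_succ_apply']; exact hf _ (ih p hp)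
  have hinj : ∀ j ≤ N, ∀ p ∈ C, ∀ q ∈ C, f^[j] p = f^[j] q → p = q := by
    intro j hj p hp q hq h
    rw [← hfN p hp, ← hfN q hq, ← Nat.sub_add_cancel hj, Function.iterate_add_apply,
      Function.iterate_add_apply, h]
  have hyN : ∀ p ∈ C, ∀ j, 1 ≤ j → j ≤ N → y p j ≤ y p N := by
    intro p hp j h₁ h₂
    rcases h₂.eq_or_lt with rfl | h
    · exact le_rfl
    · exact (hy p hp j N h₁ h le_rfl).le
  have hx0 : ∀ p ∈ C, ∀ j < N, x p 0 ≤ x p j := by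
    intro p hp j hj
    rcases Nat.eq_zero_or_pos j with rfl | h
    · exact le_rfl
    · exact (Nat.le_add_right _ _).trans (hx p hp 0 j h hj)
  have hxN : ∀ p ∈ C, ∀ j < N, x p j ≤ x p (N - 1) := by
    intro p hp j hj
    rcases (show j ≤ N - 1 by omega).eq_or_lt with rfl | h
    · exact le_rfl
    · exact (Nat.le_add_right _ _).trans (hx p hp j (N - 1) h (by omega))
  -- `R p q l`: the new path `p` uses position `l` of the old path `q`, either in its own prefix or
  -- suffix, or at its `j`-th stop.
  let R : Fin k → Fin k → ℕ → Prop := fun p q l =>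
    (q = p ∧ (p ∈ C → l ≤ x p 0 ∨ y p N ≤ l)) ∨
      (p ∈ C ∧ ∃ j, 1 ≤ j ∧ j < N ∧ f^[j] p = q ∧ (l = y q j ∨ (x q j < l + d ∧ l ≤ x q j)))
  let W : Fin k → Set V := fun p => {z | ∃ q l, l < len q ∧ z = v q l ∧ R p q l}
  have hmix : ∀ p p' q l, (q = p ∧ (p ∈ C → l ≤ x p 0 ∨ y p N ≤ l)) →
      (p' ∈ C ∧ ∃ j, 1 ≤ j ∧ j < N ∧ f^[j] p' = q ∧
        (l = y q j ∨ (x q j < l + d ∧ l ≤ x q j))) → False := by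
    rintro p p' q l ⟨rfl, h⟩ ⟨hp', j, hj, hjN, hq, hl⟩
    have hqC : q ∈ C := hq ▸ hfi j p' hp'
    have h₁ := hx q hqC 0 j hj hjN
    have h₂ := hxy q hqC 0 j hN hj hjN.le
    have h₃ := hy q hqC j N hj hjN le_rfl
    have h₄ := hxy q hqC j N hjN hN le_rfl
    have := h hqC
    omega
  have huniq : ∀ p p' q l, R p q l → R p' q l → p = p' := by
    rintro p p' q l (h | h) (h' | h')
    · exact h.1.symm.trans h'.1
    · exact (hmix _ _ _ _ h h').elim
    · exact (hmix _ _ _ _ h' h).elim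
    · obtain ⟨hp, j, hj, hjN, hq, hl⟩ := h
      obtain ⟨hp', j', hj', hjN', hq', hl'⟩ := h'
      have hqC : q ∈ C := hq ▸ hfi j p hp
      obtain rfl : j = j' := by
        have h₁ := hxy q hqC j j' hjN hj' hjN'.le
        have h₂ := hxy q hqC j' j hjN' hj hjN.le
        rcases lt_trichotomy j j' with h | h | h
        · have h₃ := hx q hqC j j' h hjN'
          have h₄ := hy q hqC j j' hj h hjN'.le
          omega
        · exact h
        · have h₃ := hx q hqC j' j h hjN
          have h₄ := hy q hqC j' j hj' h hjN.le
          omega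
      exact hinj j hjN.le p hp p' hp' (hq.trans hq'.symm)
  obtain ⟨q₀, hq₀⟩ := hne
  have hq₀y := hxy q₀ hq₀ (N - 1) N (by omega) hN le_rfl
  -- The position just after the last `x` exceeds all prefixes and stopping windows, and precedes
  -- every `y`. No new path uses it.
  have h := H.card_le_of_avoid (W := W) ?_ ?_ q₀ {x q₀ (N - 1) + 1}
    (by have := hyl q₀ hq₀; simp; omega) ∅ ?_
  · simp at h
  · intro p p' hpp
    rw [Set.disjoint_left]
    rintro z ⟨q, l, hl, rfl, hR⟩ ⟨q', l', hl', he, hR'⟩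
    obtain ⟨rfl, rfl⟩ := H.inj hl hl' he
    exact hpp (huniq _ _ _ _ hR hR')
  · intro p
    rw [← H.source, ← H.target]
    have hpos := H.pos p
    by_cases hp : p ∈ C
    · have hpx := hxy p hp 0 N hN hN le_rfl
      have hpy := hyl p hp
      refine ⟨⟨p, 0, hpos, rfl, Or.inl ⟨rfl, fun _ => by omega⟩⟩, ?_⟩
      have key : ∀ j < N, Relation.ReflTransGen (fun a b => G.Adj a b ∧ b ∈ W p) (v p 0)
          (v (f^[j] p) (x (f^[j] p) j)) := by
        intro j
        induction j with
        | zero =>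
          intro _
          exact H.reach_segment (by omega) (by simp; omega) fun l _ hl =>
            ⟨p, l, by simp at hl; omega, rfl, Or.inl ⟨rfl, fun _ => Or.inl hl⟩⟩
        | succ j ih =>
          intro hj
          have hqC := hfi (j + 1) p hp
          have hrC := hfi j p hp
          set q := f^[j + 1] p with hq
          have hfq : f (f^[j] p) = q := (Function.iterate_succ_apply' f j p).symm
          have e := hadj _ hrC j (by omega)
          rw [hfq] at e
          have hyq := hyN q hqC (j + 1) (by omega) hj.le
          have hylq := hyl q hqC
          have hxyq := hxy q hqC (j + 1) (j + 1) hj (by omega) hj.le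
          have hxq := hx q hqC 0 (j + 1) (by omega) hj
          -- The window of `d` vertices ending at `x q (j + 1)`. The subtraction is not truncated,
          -- since `x q (j + 1)` is at least `x q 0 + d`.
          obtain ⟨l, h₁, h₂, h₃⟩ := H.exists_adj_window_back hd hG (p := q)
            (i := x q (j + 1) + 1 - d) (j := y q (j + 1)) (by omega) (by omega)
          have hD : ∀ l, x q (j + 1) < l + d → l ≤ x q (j + 1) → v q l ∈ W p := fun l h h' =>
            ⟨q, l, by omega, rfl, Or.inr ⟨hp, j + 1, by omega, hj, rfl, Or.inr ⟨h, h'⟩⟩⟩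
          refine (((ih (by omega)).tail ⟨e, ?_⟩).tail ⟨h₃, hD l (by omega) (by omega)⟩).trans ?_
          · exact ⟨q, y q (j + 1), by omega, rfl,
              Or.inr ⟨hp, j + 1, by omega, hj, rfl, Or.inl rfl⟩⟩
          · exact H.reach_segment (by omega) (by omega) fun l' _ _ => hD l' (by omega) (by omega)
      have e := hadj _ (hfi (N - 1) p hp) (N - 1) (by omega)
      have hfp : f (f^[N - 1] p) = p := by
        rw [← Function.iterate_succ_apply' f, Nat.succ_eq_add_one, Nat.sub_add_cancel hN, hfN p hp]
      rw [hfp, Nat.sub_add_cancel hN] at e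
      have hT : ∀ l, y p N ≤ l → l < len p → v p l ∈ W p := fun l h h' =>
        ⟨p, l, h', rfl, Or.inl ⟨rfl, fun _ => Or.inr h⟩⟩
      exact ((key (N - 1) (by omega)).tail ⟨e, hT _ le_rfl hpy⟩).trans
        (H.reach_segment (by omega) (by omega) fun l _ _ => hT l (by omega) (by omega))
    · have hT : ∀ l, l < len p → v p l ∈ W p := fun l h' =>
        ⟨p, l, h', rfl, Or.inl ⟨rfl, fun h => absurd h hp⟩⟩
      exact ⟨hT 0 hpos, H.reach_segment (by omega) (by omega) fun l _ _ => hT l (by omega)⟩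
  · rintro p z ⟨q, l, hl, rfl, hR⟩
    refine Or.inr ⟨q, l, hl, rfl, ?_⟩
    rintro rfl hlR
    rw [Finset.mem_singleton] at hlR
    subst hlR
    rcases hR with ⟨rfl, h⟩ | ⟨hp, j, hj, hjN, hq, h⟩
    · have := h hq₀
      have := hx0 q hq₀ (N - 1) (by omega)
      omega
    · have := hxN q hq₀ j hjN
      have := hxy q hq₀ (N - 1) j (by omega) hj hjN.le
      omega

/-- There are sets of `m` vertices among the first `a p` of path `p` and among the others than the
first `a q` of path `q`, with all edges from the first set to the second. -/
def Clash (G : Digraph V) (len : Fin k → ℕ) (v : Fin k → ℕ → V) (m : ℕ) (a : Fin k → ℕ)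
    (p q : Fin k) : Prop :=
  ∃ A B : Finset ℕ, A.card = m ∧ B.card = m ∧ (∀ i ∈ A, i < a p) ∧
    (∀ j ∈ B, a q ≤ j ∧ j < len q) ∧ ∀ i ∈ A, ∀ j ∈ B, G.Adj (v p i) (v q j)

/-- The quantitative form of monotonicity turns elements whose ranks differ by `d` into positions at
least `d` apart. -/
theorem exists_enumeration (A : Finset ℕ) :
    ∃ g : ℕ → ℕ, (∀ i < A.card, g i ∈ A) ∧ ∀ i j, i ≤ j → j < A.card → g i + (j - i) ≤ g j := by
  classical
  let e := A.orderEmbOfFin rfl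
  let g : ℕ → ℕ := fun i => if h : i < A.card then e ⟨i, h⟩ else 0
  have hg : ∀ i (h : i < A.card), g i = e ⟨i, h⟩ := fun i h => dif_pos h
  refine ⟨g, fun i hi => by rw [hg i hi]; exact Finset.orderEmbOfFin_mem _ _ _, ?_⟩
  intro i j hij
  induction j, hij using Nat.le_induction with
  | base => simp
  | succ j hij ih =>
    intro hj
    have h₁ := ih (by omega)
    have h₂ : g j < g (j + 1) := by
      rw [hg j (by omega), hg _ hj]
      exact e.strictMono (by simp)
    omega

/-- One exponent serves all self-maps, so that the clash bound depends only on `d` and `k`. A point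
`f^[N] p` then lies on a cycle of `f` and is fixed by `f^[N]`. -/
theorem exists_iterate_idempotent (k : ℕ) :
    ∃ N, 1 ≤ N ∧ ∀ (f : Fin k → Fin k) (p : Fin k), f^[N] (f^[N] p) = f^[N] p := by
  have key : ∀ f : Fin k → Fin k, ∃ N, 1 ≤ N ∧ ∀ M, N ∣ M → 1 ≤ M → f^[M + M] = f^[M] := by
    intro f
    obtain ⟨i, j, hij, h⟩ := Finite.exists_ne_map_eq_of_infinite fun i : ℕ => f^[i]
    wlog hlt : i < j generalizing i j
    · exact this j i hij.symm h.symm (by omega)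
    have hper : ∀ c l, i ≤ l → f^[l + c * (j - i)] = f^[l] := by
      intro c
      induction c with
      | zero => simp
      | succ c ih =>
        intro l hl
        have e : l + (c + 1) * (j - i) = (l - i) + c * (j - i) + j := by
          rw [Nat.succ_mul]; omega
        have e' : l + c * (j - i) = (l - i) + c * (j - i) + i := by omega
        rw [e, Function.iterate_add, ← h, ← Function.iterate_add, ← e', ih l hl]
    -- Iterates have period `j - i` from exponent `i` on; the factor `i + 1` puts every positive
    -- multiple in that range.
    refine ⟨(i + 1) * (j - i), Nat.mul_pos (by omega) (by omega), ?_⟩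
    rintro M ⟨c, rfl⟩ hM
    have hc : 1 ≤ c := by
      rcases Nat.eq_zero_or_pos c with rfl | h
      · simp at hM
      · exact h
    have := hper (c * (i + 1)) ((i + 1) * (j - i) * c) (by
      have := Nat.mul_le_mul (Nat.mul_le_mul (le_refl (i + 1)) (Nat.sub_pos_of_lt hlt)) hc
      simp only [Nat.succ_eq_add_one] at this
      omega)
    rwa [show c * (i + 1) * (j - i) = (i + 1) * (j - i) * c by ring] at this
  choose F hF hF' using key
  refine ⟨∏ f, F f, Nat.succ_le_of_lt (Finset.prod_pos fun f _ => hF f), fun f p => ?_⟩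
  rw [← Function.iterate_add_apply, hF' f _ (Finset.dvd_prod_of_mem F (Finset.mem_univ f))
    (Nat.succ_le_of_lt (Finset.prod_pos fun f _ => hF f))]

/-- If the number `m` is large then, in a dominant digraph, the paths of a shortest linkage can be
traversed simultaneously so that there never is a clash. -/
theorem exists_clash_bound (d k : ℕ) (hd : 1 ≤ d) :
    ∃ m, 2 ≤ m ∧ ∀ {V : Type} [Finite V] {G : Digraph V} {s t : Fin k → V} {len : Fin k → ℕ}
      {v : Fin k → ℕ → V}, ShortestLinkage G s t len v → IsPathDominant d G →
      ∀ a : Fin k → ℕ, (∀ p q, ¬ Clash G len v m a p q) → (∃ p, a p < len p) →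
        ∃ p, a p < len p ∧
          ∀ p' q, ¬ Clash G len v m (Function.update a p (a p + 1)) p' q := by
  obtain ⟨N, hN, hidem⟩ := exists_iterate_idempotent k
  -- Sufficiently large: ranks `j * d` with `j < N`, and two further ranks beyond each, are needed
  -- in the first set, and `N` ranks in the second.
  refine ⟨N * d + N + 3, by omega, ?_⟩
  intro V _ G s t len v H hG a hinv ⟨p₀, hp₀⟩
  by_contra! hcon
  -- Advancing `p` only shrinks what lies ahead. A clash that is new must therefore start from `p`.
  have hstep : ∀ p, a p < len p → ∃ q, a q < len q ∧ ∃ A B : Finset ℕ,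
      A.card = N * d + N + 3 ∧ B.card = N * d + N + 3 ∧ (∀ i ∈ A, i ≤ a p) ∧
      (∀ j ∈ B, a q ≤ j ∧ j < len q) ∧ ∀ i ∈ A, ∀ j ∈ B, G.Adj (v p i) (v q j) := by
    intro p hp
    obtain ⟨p', q, A, B, hA, hB, hAp, hBq, hAB⟩ := hcon p hp
    have hBq' : ∀ j ∈ B, a q ≤ j ∧ j < len q := by
      intro j hj
      have := hBq j hj
      by_cases hqp : q = p
      · subst hqp
        simp at this
        omega
      · rwa [Function.update_of_ne hqp] at this
    by_cases hpp : p' = p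
    · subst hpp
      have hBne : B.Nonempty := Finset.card_pos.1 (by omega)
      obtain ⟨j, hj⟩ := hBne
      refine ⟨q, (hBq' j hj).1.trans_lt (hBq' j hj).2, A, B, hA, hB, fun i hi => ?_, hBq', hAB⟩
      have := hAp i hi
      simp at this
      omega
    · refine (hinv p' q ⟨A, B, hA, hB, fun i hi => ?_, hBq', hAB⟩).elim
      have := hAp i hi
      rwa [Function.update_of_ne hpp] at this
  choose! f hf A B hA hB hAp hBq hAB using hstep
  choose gA hgA hgA' using fun p => exists_enumeration (A p)
  choose gB hgB hgB' using fun p => exists_enumeration (B p)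
  have hfi : ∀ j p, a p < len p → a (f^[j] p) < len (f^[j] p) := by
    intro j
    induction j with
    | zero => exact fun p hp => hp
    | succ j ih => exact fun p hp => by rw [Function.iterate_succ_apply']; exact hf _ (ih p hp)
  have hNd : ∀ i < N, i * d + d ≤ N * d := fun i hi => by
    rw [← Nat.succ_mul]; exact Nat.mul_le_mul_right d hi
  refine H.no_cyclic_detour hd hG f hN {p | a p < len p ∧ f^[N] p = p}
    ⟨f^[N] p₀, hfi N p₀ hp₀, hidem f p₀⟩ (fun p hp => ⟨hf p hp.1, ?_⟩) (fun p hp => hp.2)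
    -- The landing positions on `p` come from the clash of its predecessor on the cycle, which is
    -- `f^[N - 1] p`.
    (fun p j => gA p (j * d)) (fun p j => gB (f^[N - 1] p) (j - 1)) ?_ ?_ ?_ ?_ ?_
  · rw [← Function.iterate_succ_apply, Function.iterate_succ_apply', hp.2]
  · intro p hp i j hij hj
    have h₁ := hNd j hj
    have h₂ : i * d + d ≤ j * d := by rw [← Nat.succ_mul]; exact Nat.mul_le_mul_right d hij
    have h₃ := hgA' p (i * d) (j * d) (by omega) (by rw [hA p hp.1]; omega)
    omega
  all_goals
    have hpre : ∀ p, a p < len p ∧ f^[N] p = p →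
        a (f^[N - 1] p) < len (f^[N - 1] p) ∧ f (f^[N - 1] p) = p := by
      rintro p ⟨h₁, h₂⟩
      refine ⟨hfi _ p h₁, ?_⟩
      rw [← Function.iterate_succ_apply' f, Nat.succ_eq_add_one, Nat.sub_add_cancel hN, h₂]
  · intro p hp i j hi hj hjN
    obtain ⟨h₁, h₂⟩ := hpre p hp
    have h₃ := hBq _ h₁ _ (hgB (f^[N - 1] p) (j - 1) (by rw [hB _ h₁]; omega))
    rw [h₂] at h₃
    have h₄ := hNd i hi
    have h₅ := hAp p hp.1 _ (hgA p (i * d + 2) (by rw [hA p hp.1]; omega))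
    have h₆ := hgA' p (i * d) (i * d + 2) (by omega) (by rw [hA p hp.1]; omega)
    omega
  · intro p hp i j hi hij hj
    obtain ⟨h₁, h₂⟩ := hpre p hp
    have := hgB' (f^[N - 1] p) (i - 1) (j - 1) (by omega) (by rw [hB _ h₁]; omega)
    omega
  · intro p hp
    obtain ⟨h₁, h₂⟩ := hpre p hp
    have h₃ := hBq _ h₁ _ (hgB (f^[N - 1] p) (N - 1) (by rw [hB _ h₁]; omega))
    rw [h₂] at h₃
    exact h₃.2
  · intro p hp j hj
    have h₂ : f^[N - 1] (f p) = p := by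
      rw [← Function.iterate_succ_apply f, Nat.succ_eq_add_one, Nat.sub_add_cancel hN, hp.2]
    rw [h₂]
    have := hNd j hj
    exact hAB p hp.1 _ (hgA p _ (by rw [hA p hp.1]; omega)) _
      (hgB p _ (by rw [hB p hp.1]; omega))

end TimeOrder

/-! ### The graph of states -/

section StateGraph

/-- A state `σ` consists of the current ends `σ 0, …, σ (k - 1)` of the paths, of `k` windows of `c`
vertices each, and of `M` exceptional vertices; the value `n` stands for a missing vertex. A vertex
is safe if it is not in a window, and is exceptional or has less than `m` in-neighbours in each
window. -/
def Safe (k c m M : ℕ) (E : ℕ → ℕ → ℕ) (σ : ℕ → ℕ) (z : ℕ) : Prop :=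
  (∀ i < k * c, σ (k + i) ≠ z) ∧
    ((∃ i < M, σ (k + k * c + i) = z) ∨
      ∀ p < k, ∑ i ∈ Finset.range c, E (σ (k + (p * c + i))) z < m)

/-- In a step, one of the paths is extended by a safe vertex, which is no longer safe afterwards,
and no vertex becomes safe. -/
def Step (k c m M n : ℕ) (E : ℕ → ℕ → ℕ) (S : ℕ → ℕ) (σ τ : ℕ → ℕ) : Prop :=
  (∃ p < k, ((σ p = n ∧ τ p = S p) ∨ E (σ p) (τ p) ≠ 0) ∧ τ p < n ∧
      (∀ q < k, q ≠ p → τ q = σ q) ∧ Safe k c m M E σ (τ p) ∧ ¬ Safe k c m M E τ (τ p)) ∧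
    ∀ z < n, Safe k c m M E τ z → Safe k c m M E σ z

theorem ReachIn.mono {V : Type*} {G : Digraph V} {U U' : Set V} {a b : V} (h : ReachIn G U a b)
    (hU : U ⊆ U') : ReachIn G U' a b :=
  ⟨hU h.1, Relation.ReflTransGen.lift id (fun _ _ h => ⟨h.1, hU h.2⟩) _ _ h.2⟩

/-! ### Walks of states yield disjoint paths -/

section Soundness

variable {k c m M n : ℕ} {G : Digraph (Fin n)} {s t : Fin k → Fin n} {E : ℕ → ℕ → ℕ} {S : ℕ → ℕ}

/-- The paths built so far are disjoint, and avoid the safe vertices. -/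
def Good (k c m M : ℕ) {n : ℕ} (G : Digraph (Fin n)) (s : Fin k → Fin n) (E : ℕ → ℕ → ℕ)
    (σ : ℕ → ℕ) : Prop :=
  ∃ U : Fin k → Set (Fin n), (∀ p q, p ≠ q → Disjoint (U p) (U q)) ∧
    (∀ p : Fin k, (σ p = n ∧ U p = ∅) ∨ ∃ h : σ p < n, ReachIn G (U p) (s p) ⟨σ p, h⟩) ∧
    ∀ z : Fin n, Safe k c m M E σ z → ∀ p, z ∉ U p

theorem good_init {σ : ℕ → ℕ} (h : ∀ p < k, σ p = n) : Good k c m M G s E σ :=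
  ⟨fun _ => ∅, by simp, fun p => Or.inl ⟨h p p.2, rfl⟩, by simp⟩

theorem Good.hasLinkage {σ : ℕ → ℕ} (h : Good k c m M G s E σ)
    (ht : ∀ p : Fin k, σ p = t p) : HasLinkage G s t := by
  obtain ⟨U, hU, hr, -⟩ := h
  refine hasLinkage_of_reachIn hU fun p => ?_
  rcases hr p with ⟨h, -⟩ | ⟨h, hr⟩
  · have := (t p).2
    have := ht p
    omega
  · rwa [show t p = ⟨σ p, h⟩ from Fin.ext (ht p).symm]

/-- The windows and exceptional vertices of `τ` need not be related to those of `σ`: only the set of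
safe vertices matters. The new vertex was safe, hence outside all `U q`. Afterwards it is unsafe,
and previously unsafe vertices stay unsafe. -/
theorem Good.step {σ τ : ℕ → ℕ} (hE : ∀ u v, u ≤ n → v < n → E u v ≠ 0 →
      ∃ (hu : u < n) (hv : v < n), G.Adj ⟨u, hu⟩ ⟨v, hv⟩)
    (hS : ∀ p : Fin k, S p = s p) (hσ : ∀ i, σ i ≤ n) (h : Good k c m M G s E σ)
    (hst : Step k c m M n E S σ τ) : Good k c m M G s E τ := by
  obtain ⟨U, hU, hr, hsafe⟩ := h
  obtain ⟨⟨p, hp, hedge, hlt, hq, hs, hns⟩, hmono⟩ := hst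
  have hxU : ∀ q, (⟨τ p, hlt⟩ : Fin n) ∉ U q := hsafe ⟨τ p, hlt⟩ hs
  have hreach : ReachIn G (insert ⟨τ p, hlt⟩ (U ⟨p, hp⟩)) (s ⟨p, hp⟩) ⟨τ p, hlt⟩ := by
    rcases hedge with ⟨-, h₂⟩ | h
    · have e : (⟨τ p, hlt⟩ : Fin n) = s ⟨p, hp⟩ := Fin.ext (h₂.trans (hS ⟨p, hp⟩))
      rw [e]
      exact ⟨Set.mem_insert _ _, .refl⟩
    · obtain ⟨hu, _, hadj⟩ := hE _ _ (hσ p) hlt h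
      rcases hr ⟨p, hp⟩ with ⟨h, -⟩ | ⟨h, hr⟩
      · exact absurd h hu.ne
      · have := hr.mono (Set.subset_insert (⟨τ p, hlt⟩ : Fin n) _)
        exact ⟨this.1, this.2.tail ⟨hadj, Set.mem_insert _ _⟩⟩
  refine ⟨Function.update U ⟨p, hp⟩ (insert ⟨τ p, hlt⟩ (U ⟨p, hp⟩)), ?_, ?_, ?_⟩
  · have key : ∀ q, q ≠ ⟨p, hp⟩ → Disjoint (insert ⟨τ p, hlt⟩ (U ⟨p, hp⟩)) (U q) := fun q hqp =>
      Set.disjoint_insert_left.2 ⟨hxU q, hU _ _ hqp.symm⟩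
    intro q q' hqq
    by_cases h₁ : q = ⟨p, hp⟩
    · subst h₁
      rw [Function.update_self, Function.update_of_ne hqq.symm]
      exact key q' hqq.symm
    · rw [Function.update_of_ne h₁]
      by_cases h₂ : q' = ⟨p, hp⟩
      · subst h₂
        rw [Function.update_self]
        exact (key q h₁).symm
      · rw [Function.update_of_ne h₂]
        exact hU q q' hqq
  · intro q
    by_cases h₁ : q = ⟨p, hp⟩
    · subst h₁
      rw [Function.update_self]
      exact Or.inr ⟨hlt, hreach⟩
    · rw [Function.update_of_ne h₁]
      have e : τ q = σ q := hq q q.2 fun h => h₁ (Fin.ext h)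
      simp only [e]
      exact hr q
  · intro z hz q hzq
    by_cases h₁ : q = ⟨p, hp⟩
    · subst h₁
      rw [Function.update_self] at hzq
      rcases hzq with rfl | hzq
      · exact hns hz
      · exact hsafe z (hmono z z.2 hz) _ hzq
    · rw [Function.update_of_ne h₁] at hzq
      exact hsafe z (hmono z z.2 hz) _ hzq

end Soundness

/-! ### Shortest linkages yield walks of states -/

section Completeness

variable {k n : ℕ} {G : Digraph (Fin n)} {s t : Fin k → Fin n} {len : Fin k → ℕ}
  {v : Fin k → ℕ → Fin n}

/-- When `a p` vertices of path `p` have been traversed, this is the `i`-th one from the end, and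
`n` if there is none. -/
def recent (v : Fin k → ℕ → Fin n) (a : Fin k → ℕ) (p i : ℕ) : ℕ :=
  if h : ∃ hp : p < k, i < a ⟨p, hp⟩ then v ⟨p, h.1⟩ (a ⟨p, h.1⟩ - 1 - i) else n

theorem recent_of_lt {a : Fin k → ℕ} {p : Fin k} {i : ℕ} (h : i < a p) :
    recent v a p i = v p (a p - 1 - i) :=
  dif_pos ⟨p.2, h⟩

theorem recent_of_le {a : Fin k → ℕ} {p : Fin k} {i : ℕ} (h : a p ≤ i) :
    recent v a p i = n :=
  dif_neg fun ⟨_, h'⟩ => h.not_gt h'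

theorem recent_le (a : Fin k → ℕ) (p i : ℕ) : recent v a p i ≤ n := by
  unfold recent
  split_ifs
  · exact (v _ _).2.le
  · exact le_rfl

open Classical in
/-- The positions, among the last `c` traversed vertices of path `p`, of the in-neighbours
of `z`. -/
noncomputable def inPositions (G : Digraph (Fin n)) (v : Fin k → ℕ → Fin n) (c : ℕ)
    (a : Fin k → ℕ) (p : Fin k) (z : Fin n) : Finset ℕ :=
  (Finset.range c).filter fun i => i < a p ∧ G.Adj (v p (a p - 1 - i)) z

open Classical in
/-- The vertices ahead that have many in-neighbours among the last traversed ones of some path. -/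
noncomputable def exceptional (G : Digraph (Fin n)) (len : Fin k → ℕ) (v : Fin k → ℕ → Fin n)
    (c m : ℕ) (a : Fin k → ℕ) : Finset (Fin n) :=
  Finset.univ.filter fun z => (∃ q j, a q ≤ j ∧ j < len q ∧ z = v q j) ∧
    ∃ p, m ≤ (inPositions G v c a p z).card

theorem mem_exceptional {c m : ℕ} {a : Fin k → ℕ} {z : Fin n} :
    z ∈ exceptional G len v c m a ↔ (∃ q j, a q ≤ j ∧ j < len q ∧ z = v q j) ∧
      ∃ p, m ≤ (inPositions G v c a p z).card := by
  simp [exceptional]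

/-- For each pair of paths `p`, `q`, vertices ahead on `q` are classified by their in-neighbour
positions in the window of `p`, giving at most `2 ^ c` classes. A class with more than `m` members,
all having at least `m` common in-neighbours, contains a clash. -/
theorem card_exceptional_le {c m : ℕ} {a : Fin k → ℕ} (h : ∀ p q, ¬ Clash G len v m a p q) :
    (exceptional G len v c m a).card ≤ k * k * (m * 2 ^ c) := by
  classical
  let J : Fin k → Fin k → Finset ℕ := fun p q =>
    (Finset.range (len q)).filter fun j => a q ≤ j ∧ m ≤ (inPositions G v c a p (v q j)).card
  have hJ : ∀ p q, (J p q).card ≤ m * 2 ^ c := by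
    intro p q
    by_contra! hlt
    obtain ⟨y, -, hy⟩ := Finset.exists_lt_card_fiber_of_mul_lt_card_of_maps_to (s := J p q)
      (t := (Finset.range c).powerset) (f := fun j => inPositions G v c a p (v q j)) (n := m)
      (fun j _ => Finset.mem_powerset.2 (Finset.filter_subset _ _))
      (by rw [Finset.card_powerset, Finset.card_range, mul_comm]; exact hlt)
    obtain ⟨j₀, hj₀⟩ := Finset.card_pos.1 (Nat.zero_lt_of_lt hy)
    rw [Finset.mem_filter, Finset.mem_filter] at hj₀
    have hym : m ≤ y.card := hj₀.2 ▸ hj₀.1.2.2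
    obtain ⟨A, hAy, hA⟩ := Finset.exists_subset_card_eq hym
    obtain ⟨B, hBy, hB⟩ := Finset.exists_subset_card_eq hy.le
    have hylt : ∀ i ∈ y, i < a p := by
      intro i hi
      rw [← hj₀.2, inPositions, Finset.mem_filter] at hi
      exact hi.2.1
    refine h p q ⟨A.image fun i => a p - 1 - i, B, ?_, hB, ?_, ?_, ?_⟩
    · rw [Finset.card_image_of_injOn, hA]
      intro i hi j hj hij
      have h₁ := hylt i (hAy hi)
      have h₂ := hylt j (hAy hj)
      simp only at hij
      omega
    · intro i hi
      obtain ⟨i', hi', rfl⟩ := Finset.mem_image.1 hi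
      have h₁ := hylt i' (hAy hi')
      omega
    · intro j hj
      have := hBy hj
      rw [Finset.mem_filter, Finset.mem_filter, Finset.mem_range] at this
      exact ⟨this.1.2.1, this.1.1⟩
    · intro i hi j hj
      obtain ⟨i', hi', rfl⟩ := Finset.mem_image.1 hi
      have h₁ := hAy hi'
      have h₂ := (Finset.mem_filter.1 (hBy hj)).2
      rw [← h₂, inPositions, Finset.mem_filter] at h₁
      exact h₁.2.2
  have hsub : exceptional G len v c m a ⊆
      (Finset.univ : Finset (Fin k × Fin k)).biUnion fun x => (J x.1 x.2).image (v x.2) := by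
    intro z hz
    obtain ⟨⟨q, j, h₁, h₂, rfl⟩, p, h₃⟩ := mem_exceptional.1 hz
    refine Finset.mem_biUnion.2 ⟨(p, q), Finset.mem_univ _, Finset.mem_image.2 ⟨j, ?_, rfl⟩⟩
    simp only [J, Finset.mem_filter, Finset.mem_range]
    exact ⟨h₂, h₁, h₃⟩
  refine (Finset.card_le_card hsub).trans ((Finset.card_biUnion_le_card_mul _ _ (m * 2 ^ c) ?_).trans
    (by simp))
  exact fun x _ => Finset.card_image_le.trans (hJ _ _)

/-- The state of the algorithm when `a p` vertices of each path `p` have been traversed. -/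
noncomputable def stateOf (G : Digraph (Fin n)) (len : Fin k → ℕ) (v : Fin k → ℕ → Fin n)
    (c m M : ℕ) (a : Fin k → ℕ) (j : ℕ) : ℕ :=
  if j < k then recent v a j 0
  else if j < k + k * c then recent v a ((j - k) / c) ((j - k) % c)
  else if j < k + k * c + M then
    ((exceptional G len v c m a).toList.map fun x : Fin n => (x : ℕ)).getD (j - (k + k * c)) n
  else 0

theorem stateOf_le (c m M : ℕ) (a : Fin k → ℕ) (j : ℕ) : stateOf G len v c m M a j ≤ n := by
  unfold stateOf
  split_ifs
  · exact recent_le _ _ _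
  · exact recent_le _ _ _
  · rw [List.getD_eq_getElem?_getD, List.getElem?_map]
    cases (exceptional G len v c m a).toList[j - (k + k * c)]? with
    | none => simp
    | some x => simp
  · exact Nat.zero_le _

theorem stateOf_end (c m M : ℕ) (a : Fin k → ℕ) (p : Fin k) :
    stateOf G len v c m M a p = recent v a p 0 :=
  if_pos p.2

theorem stateOf_window {c : ℕ} (m M : ℕ) (a : Fin k → ℕ) (p : Fin k) {i : ℕ} (hi : i < c) :
    stateOf G len v c m M a (k + (p * c + i)) = recent v a p i := by
  have h : (p : ℕ) * c + c ≤ k * c := by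
    rw [← Nat.succ_mul]; exact Nat.mul_le_mul_right c p.2
  unfold stateOf
  rw [if_neg (by omega), if_pos (by omega), Nat.add_sub_cancel_left, Nat.mul_comm,
    Nat.mul_add_div (by omega), Nat.mul_add_mod, Nat.div_eq_of_lt hi, Nat.mod_eq_of_lt hi, add_zero]

theorem safe_stateOf_iff {c m M : ℕ} {E : ℕ → ℕ → ℕ} {a : Fin k → ℕ}
    (hE : ∀ u v : Fin n, (G.Adj u v → E u v = 1) ∧ (¬ G.Adj u v → E u v = 0))
    (hE' : ∀ v : Fin n, E n v = 0)
    (hM : (exceptional G len v c m a).card ≤ M) (z : Fin n) :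
    Safe k c m M E (stateOf G len v c m M a) z ↔
      (∀ p, ∀ i < c, i < a p → v p (a p - 1 - i) ≠ z) ∧
        (z ∈ exceptional G len v c m a ∨ ∀ p, (inPositions G v c a p z).card < m) := by
  unfold Safe
  refine and_congr ⟨?_, ?_⟩ (or_congr ⟨?_, ?_⟩ ?_)
  · rintro h p i hi hip rfl
    have h' : (p : ℕ) * c + c ≤ k * c := by
      rw [← Nat.succ_mul]; exact Nat.mul_le_mul_right c p.2
    refine h (p * c + i) (by omega) ?_
    rw [stateOf_window m M a p hi, recent_of_lt hip]
  · intro h i hi hiz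
    have hc : 0 < c := Nat.pos_of_ne_zero (by rintro rfl; simp at hi)
    have hp : i / c < k := (Nat.div_lt_iff_lt_mul hc).2 hi
    have hi' : i = (⟨i / c, hp⟩ : Fin k) * c + i % c := by
      simp only; rw [mul_comm, Nat.div_add_mod]
    have hic := Nat.mod_lt i hc
    rw [hi', stateOf_window m M a _ hic] at hiz
    rcases lt_or_ge (i % c) (a ⟨i / c, hp⟩) with hlt | hle
    · rw [recent_of_lt hlt] at hiz
      exact h _ _ hic hlt (Fin.ext hiz)
    · rw [recent_of_le hle] at hiz
      exact absurd hiz z.2.ne'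
  · rintro ⟨i, hi, hz⟩
    unfold stateOf at hz
    rw [if_neg (by omega), if_neg (by omega), if_pos (by omega), Nat.add_sub_cancel_left,
      List.getD_eq_getElem?_getD, List.getElem?_map] at hz
    cases hx : (exceptional G len v c m a).toList[i]? with
    | none => rw [hx] at hz; exact absurd hz (by simpa using z.2.ne')
    | some x =>
      rw [hx] at hz
      obtain rfl : x = z := Fin.ext (by simpa using hz)
      exact Finset.mem_toList.1 (List.mem_of_getElem? hx)
  · intro hz
    obtain ⟨i, hi, hx⟩ := List.getElem_of_mem (Finset.mem_toList.2 hz)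
    have hi' := hi
    rw [Finset.length_toList] at hi'
    refine ⟨i, by omega, ?_⟩
    unfold stateOf
    rw [if_neg (by omega), if_neg (by omega), if_pos (by omega), Nat.add_sub_cancel_left,
      List.getD_eq_getElem?_getD, List.getElem?_map, List.getElem?_eq_getElem hi, hx]
    simp
  · have key : ∀ p : Fin k, ∑ i ∈ Finset.range c, E (stateOf G len v c m M a (k + (p * c + i))) z =
        (inPositions G v c a p z).card := by
      classical
      intro p
      rw [inPositions, Finset.card_filter]
      refine Finset.sum_congr rfl fun i hi => ?_
      rw [stateOf_window m M a p (Finset.mem_range.1 hi)]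
      rcases lt_or_ge i (a p) with hlt | hle
      · rw [recent_of_lt hlt]
        by_cases hadj : G.Adj (v p (a p - 1 - i)) z
        · rw [if_pos ⟨hlt, hadj⟩, (hE _ _).1 hadj]
        · rw [if_neg fun h => hadj h.2, (hE _ _).2 hadj]
      · rw [recent_of_le hle, hE', if_neg fun h => hle.not_gt h.1]
    exact ⟨fun h p => key p ▸ h p p.2, fun h p hp => (key ⟨p, hp⟩).trans_lt (h ⟨p, hp⟩)⟩

/-- From `lo` on, `m` disjoint `d`-windows fit into the traversed part, each contributing an
in-neighbour; all of them lie among the last `c` positions. -/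
theorem le_card_inPositions {c m d lo : ℕ} {a : Fin k → ℕ} {p : Fin k} {z : Fin n}
    (h : ∀ l, lo ≤ l → l + d ≤ a p → ∃ l', l ≤ l' ∧ l' < l + d ∧ G.Adj (v p l') z)
    (hlo : lo + m * d ≤ a p) (hc : a p ≤ lo + c) : m ≤ (inPositions G v c a p z).card := by
  classical
  have hr : ∀ r < m, r * d + d ≤ m * d := fun r hr => by
    rw [← Nat.succ_mul]; exact Nat.mul_le_mul_right d hr
  choose! g h₁ h₂ h₃ using fun r (hrm : r < m) =>
    h (lo + r * d) (by omega) (by have := hr r hrm; omega)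
  rw [← Finset.card_range m]
  refine Finset.card_le_card_of_injOn (fun r => a p - 1 - g r) ?_ ?_
  · intro r hrm
    rw [Finset.mem_coe, Finset.mem_range] at hrm
    have := hr r hrm
    have := h₁ r hrm
    have := h₂ r hrm
    simp only [inPositions, Finset.coe_filter, Finset.mem_range, Set.mem_ofPred_eq]
    refine ⟨by omega, by omega, ?_⟩
    convert h₃ r hrm using 2
    omega
  · intro r hrm r' hrm' he
    rw [Finset.mem_coe, Finset.mem_range] at hrm hrm'
    have := hr r hrm
    have := h₁ r hrm
    have := h₂ r hrm
    have := hr r' hrm'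
    have := h₁ r' hrm'
    have := h₂ r' hrm'
    simp only at he
    rcases lt_trichotomy r r' with hlt | rfl | hlt
    · have : r * d + d ≤ r' * d := by rw [← Nat.succ_mul]; exact Nat.mul_le_mul_right d hlt
      omega
    · rfl
    · have : r' * d + d ≤ r * d := by rw [← Nat.succ_mul]; exact Nat.mul_le_mul_right d hlt
      omega

/-- Three facts suffice: vertices ahead are safe before the step, traversed vertices are unsafe
after it, and a vertex off the linkage does not become safe when the window of `p` moves on. -/
theorem step_stateOf {c m M d : ℕ} {E : ℕ → ℕ → ℕ} {S : ℕ → ℕ} (hd : 1 ≤ d)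
    (hc : m * d + 2 ≤ c)
    (hE : ∀ u v : Fin n, (G.Adj u v → E u v = 1) ∧ (¬ G.Adj u v → E u v = 0))
    (hE' : ∀ v : Fin n, E n v = 0) (hS : ∀ p : Fin k, S p = s p)
    (H : ShortestLinkage G s t len v) (hG : IsPathDominant d G)
    (hM : k * k * (m * 2 ^ c) ≤ M) {a : Fin k → ℕ} {p : Fin k}
    (ha : ∀ p, a p ≤ len p) (hp : a p < len p) (hcl : ∀ p q, ¬ Clash G len v m a p q)
    (hcl' : ∀ p' q, ¬ Clash G len v m (Function.update a p (a p + 1)) p' q) :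
    Step k c m M n E S (stateOf G len v c m M a)
      (stateOf G len v c m M (Function.update a p (a p + 1))) := by
  set a' := Function.update a p (a p + 1) with ha'def
  have hap : a' p = a p + 1 := Function.update_self ..
  have haq : ∀ q, q ≠ p → a' q = a q := fun q hq => Function.update_of_ne hq ..
  have ha' : ∀ q, a' q ≤ len q := by
    intro q
    by_cases hq : q = p
    · subst hq; omega
    · rw [haq q hq]; exact ha q
  have haa : ∀ q, a q ≤ a' q := by
    intro q
    by_cases hq : q = p
    · subst hq; omega
    · rw [haq q hq]
  have iff := safe_stateOf_iff (E := E) hE hE' ((card_exceptional_le (c := c) hcl).trans hM)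
  have iff' := safe_stateOf_iff (E := E) hE hE' ((card_exceptional_le (c := c) hcl').trans hM)
  have future : ∀ q j, a q ≤ j → j < len q →
      Safe k c m M E (stateOf G len v c m M a) (v q j) := by
    intro q j h₁ h₂
    refine (iff _).2 ⟨fun q' i _ hi h => ?_, ?_⟩
    · have := ha q'
      obtain ⟨rfl, h⟩ := H.inj (by omega) h₂ h
      omega
    · by_contra! hcon
      obtain ⟨h₃, p', h₄⟩ := hcon
      exact h₃ (mem_exceptional.2 ⟨⟨q, j, h₁, h₂, rfl⟩, p', h₄⟩)
  have past : ∀ q j, j < a' q → ¬ Safe k c m M E (stateOf G len v c m M a') (v q j) := by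
    intro q j hj hsafe
    have hlq := ha' q
    obtain ⟨h₁, h₂⟩ := (iff' _).1 hsafe
    rcases h₂ with h₂ | h₂
    · obtain ⟨⟨q', j', h₃, h₄, h₅⟩, -⟩ := mem_exceptional.1 h₂
      obtain ⟨rfl, rfl⟩ := H.inj (by omega) h₄ h₅
      omega
    · have hjc : j + c < a' q := by
        by_contra! hle
        refine h₁ q (a' q - 1 - j) (by omega) (by omega) ?_
        congr 1
        omega
      -- The vertex has left the window, so all positions from `lo` on are at least `j + 2`. No edge
      -- from it reaches them, and domination gives edges towards it.
      refine (h₂ q).not_ge (le_card_inPositions (d := d) (lo := a' q - c + 1) ?_ (by omega)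
        (by omega))
      intro l hl hld
      obtain ⟨l', h₃, h₄, h₅ | h₅⟩ := H.exists_adj_window hd hG (z := v q j) (p := q) (i := l)
        (by omega) (fun l' h₃ h₄ h₅ => by
          have := (H.inj (show l' < len q by omega) (by omega) h₅).2; omega)
      · have := H.le_succ_of_adj (by omega) h₅
        omega
      · exact ⟨l', h₃, h₄, h₅⟩
  have outside : ∀ z : Fin n, (∀ q j, j < len q → v q j ≠ z) →
      Safe k c m M E (stateOf G len v c m M a') z →
      Safe k c m M E (stateOf G len v c m M a) z := by
    intro z hz hsafe
    obtain ⟨h₁, h₂⟩ := (iff' _).1 hsafe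
    refine (iff _).2 ⟨fun q i _ hi => hz q _ (by have := ha q; omega), Or.inr fun q => ?_⟩
    rcases h₂ with h₂ | h₂
    · obtain ⟨⟨q', j', h₃, h₄, h₅⟩, -⟩ := mem_exceptional.1 h₂
      exact absurd h₅.symm (hz _ _ h₄)
    · by_cases hq : q = p
      · subst hq
        by_contra! hcon
        -- Only position `a q - c` leaves the window. If it is an in-neighbour of `z`, a detour
        -- through `z` is too short to reach `a q - c + 3` or beyond, so every `d`-window there
        -- contains an in-neighbour of `z`; `m` such windows fit because `m * d + 2 ≤ c`. Otherwise
        -- every old in-neighbour stays, shifted by one place.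
        by_cases hold : c ≤ a q ∧ G.Adj (v q (a q - c)) z
        · refine (h₂ q).not_ge (le_card_inPositions (d := d) (lo := a q - c + 3) ?_ (by omega)
            (by omega))
          intro l hl hld
          obtain ⟨l', h₃, h₄, h₅ | h₅⟩ := H.exists_adj_window hd hG (z := z) (p := q) (i := l)
            (by omega) (fun l' h₃ h₄ => hz _ _ (by omega))
          · have := H.le_add_two_of_adj (by omega) hz hold.2 h₅
            omega
          · exact ⟨l', h₃, h₄, h₅⟩
        · refine (h₂ q).not_ge (hcon.trans ?_)
          refine Finset.card_le_card_of_injOn (fun i => i + 1) ?_ (by simp [Set.InjOn])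
          intro i hi
          simp only [inPositions, Finset.coe_filter, Finset.mem_range, Set.mem_ofPred_eq] at hi ⊢
          obtain ⟨h₃, h₄, h₅⟩ := hi
          have e : a' q - 1 - (i + 1) = a q - 1 - i := by omega
          refine ⟨?_, by omega, e ▸ h₅⟩
          by_contra hic
          refine hold ⟨by omega, ?_⟩
          rwa [show a q - 1 - i = a q - c by omega] at h₅
      · have h := h₂ q
        unfold inPositions at h ⊢
        rwa [haq q hq] at h
  have hx : stateOf G len v c m M a' p = v p (a p) := by
    rw [stateOf_end, recent_of_lt (by omega), hap]
    simp
  refine ⟨⟨p, p.2, ?_, ?_, ?_, ?_, ?_⟩, ?_⟩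
  · rw [hx, stateOf_end]
    rcases Nat.eq_zero_or_pos (a p) with h | h
    · left
      rw [recent_of_le (by omega), h, hS, H.source]
      exact ⟨rfl, rfl⟩
    · right
      rw [recent_of_lt h, (hE _ _).1]
      · simp
      · have := H.adj (p := p) (i := a p - 1) (by omega)
        rwa [Nat.sub_add_cancel h] at this
  · rw [hx]; exact (v p (a p)).2
  · intro q hq hqp
    rw [stateOf_end c m M a' ⟨q, hq⟩, stateOf_end c m M a ⟨q, hq⟩]
    have := haq ⟨q, hq⟩ fun h => hqp (congrArg Fin.val h)
    unfold recent
    simp [hq, this]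
  · rw [hx]; exact future p (a p) le_rfl hp
  · rw [hx]; exact past p (a p) (by omega)
  · intro z hzn hz
    by_cases hL : ∃ q j, j < len q ∧ v q j = ⟨z, hzn⟩
    · obtain ⟨q, j, hj, hzq⟩ := hL
      have e : z = v q j := congrArg Fin.val hzq.symm
      subst e
      rcases lt_or_ge j (a' q) with h | h
      · exact absurd hz (past q j h)
      · exact future q j ((haa q).trans h) hj
    · push Not at hL
      exact outside ⟨z, hzn⟩ hL hz

end Completeness

/-- For suitable parameters, the linkages in dominant digraphs are found by searching the graph of
states. -/
theorem exists_state_sequence (d k : ℕ) (hd : 1 ≤ d) :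
    ∃ c m M : ℕ, ∀ (n : ℕ) (G : Digraph (Fin n)) (s t : Fin k → Fin n) (E : ℕ → ℕ → ℕ)
      (S : ℕ → ℕ), (∀ u v : Fin n, (G.Adj u v → E u v = 1) ∧ (¬ G.Adj u v → E u v = 0)) →
      (∀ v : Fin n, E n v = 0) → (∀ p : Fin k, S p = s p) → IsPathDominant d G →
      HasLinkage G s t → ∃ (T : ℕ) (σ : ℕ → ℕ → ℕ), T ≤ n ∧ (∀ i j, σ i j ≤ n) ∧
        (∀ p < k, σ 0 p = n) ∧
        (∀ i < T, Step k c m M n E S (σ i) (σ (i + 1))) ∧ ∀ p : Fin k, σ T p = t p := by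
  classical
  obtain ⟨m, hm, hclash⟩ := exists_clash_bound d k hd
  refine ⟨m * d + 2, m, k * k * (m * 2 ^ (m * d + 2)), ?_⟩
  intro n G s t E S hE hE' hS hG hL
  obtain ⟨len, v, H⟩ := exists_shortestLinkage hL
  -- Advance any path whose advance creates no clash. The default case does not occur before all
  -- paths are finished.
  let nxt : (Fin k → ℕ) → (Fin k → ℕ) := fun a =>
    if h : ∃ p, a p < len p ∧ ∀ p' q, ¬ Clash G len v m (Function.update a p (a p + 1)) p' q then
      Function.update a h.choose (a h.choose + 1) else a
  let A : ℕ → Fin k → ℕ := fun i => nxt^[i] fun _ => 0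
  have hA : ∀ i, A (i + 1) = nxt (A i) := fun i => Function.iterate_succ_apply' ..
  have hinv : ∀ i ≤ ∑ p, len p, (∀ p q, ¬ Clash G len v m (A i) p q) ∧ (∀ p, A i p ≤ len p) ∧
      ∑ p, A i p = i := by
    intro i
    induction i with
    | zero =>
      refine fun _ => ⟨?_, fun p => Nat.zero_le _, by simp [A]⟩
      rintro p q ⟨X, Y, hX, -, hXp, -⟩
      obtain ⟨x, hx⟩ := Finset.card_pos.1 (show 0 < X.card by omega)
      exact absurd (hXp x hx) (by simp [A])
    | succ i ih =>
      intro hi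
      obtain ⟨h₁, h₂, h₃⟩ := ih (by omega)
      have hex : ∃ p, A i p < len p := by
        by_contra! hcon
        have := Finset.sum_le_sum fun p (_ : p ∈ Finset.univ) => hcon p
        omega
      have h := hclash H hG (A i) h₁ hex
      obtain ⟨h₄, h₅⟩ := h.choose_spec
      have e : A (i + 1) = Function.update (A i) h.choose (A i h.choose + 1) := by
        rw [hA]; exact dif_pos h
      rw [e]
      refine ⟨h₅, fun q => ?_, ?_⟩
      · by_cases hq : q = h.choose
        · rw [hq, Function.update_self]; exact h₄
        · rw [Function.update_of_ne hq]; exact h₂ q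
      · have h₆ := Finset.add_sum_erase _ (A i) (Finset.mem_univ h.choose)
        rw [Finset.sum_update_of_mem (Finset.mem_univ _), Finset.sdiff_singleton_eq_erase]
        omega
  have hT : ∑ p, len p ≤ n := by
    have hinj : Set.InjOn (fun x : Σ _ : Fin k, ℕ => v x.1 x.2)
        (Finset.univ.sigma fun p => Finset.range (len p)) := by
      rintro ⟨p, i⟩ hi ⟨q, j⟩ hj hij
      simp only [Finset.coe_sigma, Set.mem_sigma_iff, Finset.coe_range, Set.mem_Iio] at hi hj
      obtain ⟨rfl, rfl⟩ := H.inj hi.2 hj.2 hij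
      rfl
    have := Finset.card_le_card_of_injOn (t := Finset.univ) _ (fun x _ => Finset.mem_univ _) hinj
    simpa using this
  refine ⟨∑ p, len p,
    fun i => stateOf G len v (m * d + 2) m (k * k * (m * 2 ^ (m * d + 2))) (A i), hT,
    fun i j => stateOf_le _ _ _ _ _, ?_, ?_, ?_⟩
  · intro p hp
    exact (stateOf_end _ m _ (A 0) ⟨p, hp⟩).trans (recent_of_le (by simp [A]))
  · intro i hi
    obtain ⟨h₁, h₂, h₃⟩ := hinv i hi.le
    have hex : ∃ p, A i p < len p := by
      by_contra! hcon
      have := Finset.sum_le_sum fun p (_ : p ∈ Finset.univ) => hcon p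
      omega
    have h := hclash H hG (A i) h₁ hex
    obtain ⟨h₄, h₅⟩ := h.choose_spec
    have e : A (i + 1) = Function.update (A i) h.choose (A i h.choose + 1) := by
      rw [hA]; exact dif_pos h
    simp only [e]
    exact step_stateOf hd le_rfl hE hE' hS H hG le_rfl h₂ h₄ h₁ h₅
  · intro p
    obtain ⟨-, h₂, h₃⟩ := hinv _ le_rfl
    have e : A (∑ p, len p) p = len p :=
      (Finset.sum_eq_sum_iff_of_le fun p _ => h₂ p).1 h₃ p (Finset.mem_univ p)
    have hpos := H.pos p
    beta_reduce
    rw [stateOf_end, recent_of_lt (by omega), e, ← H.target]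
    simp

end StateGraph

/-! ### Programs, conditions and running times -/

section Machine

@[simp] theorem Memory.reg_setReg (m : Memory) (x v y : ℕ) :
    (m.setReg x v).reg y = if y = x then v else m.reg y := by
  simp [Memory.setReg, Function.update_apply]

@[simp] theorem Memory.arr_setReg (m : Memory) (x v : ℕ) : (m.setReg x v).arr = m.arr := rfl

@[simp] theorem Memory.reg_setArr (m : Memory) (a i v : ℕ) : (m.setArr a i v).reg = m.reg := rfl

@[simp] theorem Memory.arr_setArr (m : Memory) (a i v b : ℕ) :
    (m.setArr a i v).arr b = if b = a then Function.update (m.arr a) i v else m.arr b := by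
  by_cases h : b = a <;> simp [Memory.setArr, h]

/-! ### Boolean expressions; a value counts as true if it is nonzero -/

namespace Expr

/-- Negation. -/
def neg (e : Expr) : Expr := .minus (.const 1) e

/-- Disjunction. -/
def or (e₁ e₂ : Expr) : Expr := .plus e₁ e₂

/-- Conjunction. -/
def and (e₁ e₂ : Expr) : Expr := neg (or (neg e₁) (neg e₂))

/-- Equality. -/
def equal (e₁ e₂ : Expr) : Expr := neg (.plus (.minus e₁ e₂) (.minus e₂ e₁))

/-- Comparison. -/
def less (e₁ e₂ : Expr) : Expr := .minus e₂ e₁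

/-- Sums of a fixed number of terms, and bounded existential quantification. -/
def sum : ℕ → (ℕ → Expr) → Expr
  | 0, _ => .const 0
  | N + 1, f => .plus (sum N f) (f N)

/-- Bounded universal quantification. -/
def all (N : ℕ) (f : ℕ → Expr) : Expr := neg (sum N fun i => neg (f i))

variable {m : Memory} {e₁ e₂ : Expr}

theorem eval_neg_ne_zero : (neg e₁).eval m ≠ 0 ↔ ¬ e₁.eval m ≠ 0 := by
  simp only [neg, eval]; omega

theorem eval_or_ne_zero : (or e₁ e₂).eval m ≠ 0 ↔ e₁.eval m ≠ 0 ∨ e₂.eval m ≠ 0 := by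
  simp only [or, eval]; omega

theorem eval_and_ne_zero : (and e₁ e₂).eval m ≠ 0 ↔ e₁.eval m ≠ 0 ∧ e₂.eval m ≠ 0 := by
  simp only [and, eval_neg_ne_zero, eval_or_ne_zero]; tauto

theorem eval_equal_ne_zero : (equal e₁ e₂).eval m ≠ 0 ↔ e₁.eval m = e₂.eval m := by
  simp only [equal, neg, eval]; omega

theorem eval_less_ne_zero : (less e₁ e₂).eval m ≠ 0 ↔ e₁.eval m < e₂.eval m := by
  simp only [less, eval]; omega

theorem eval_sum (N : ℕ) (f : ℕ → Expr) :
    (sum N f).eval m = ∑ i ∈ Finset.range N, (f i).eval m := by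
  induction N with
  | zero => rfl
  | succ N ih => rw [Finset.sum_range_succ, ← ih]; rfl

theorem eval_sum_ne_zero {N : ℕ} {f : ℕ → Expr} :
    (sum N f).eval m ≠ 0 ↔ ∃ i < N, (f i).eval m ≠ 0 := by
  simp [eval_sum]

theorem eval_all_ne_zero {N : ℕ} {f : ℕ → Expr} :
    (all N f).eval m ≠ 0 ↔ ∀ i < N, (f i).eval m ≠ 0 := by
  simp only [all, eval_neg_ne_zero, eval_sum_ne_zero]
  push Not
  rfl

end Expr

/-! ### Hoare triples with running times -/

/-- From each memory with `P`, the program halts within `T` steps in a memory with `Q`. -/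
def Triple (P : Memory → Prop) (p : Program) (T : ℕ) (Q : Memory → Prop) : Prop :=
  ∀ m, P m → ∃ m' t, Runs p m m' t ∧ t ≤ T ∧ Q m'

namespace Triple

variable {P Q R : Memory → Prop} {p q : Program} {T T' : ℕ}

theorem conseq {P' Q' : Memory → Prop} (h : Triple P p T Q) (hP : ∀ m, P' m → P m) (hT : T ≤ T')
    (hQ : ∀ m, Q m → Q' m) : Triple P' p T' Q' := fun m hm => by
  obtain ⟨m', t, h₁, h₂, h₃⟩ := h m (hP m hm)
  exact ⟨m', t, h₁, h₂.trans hT, hQ m' h₃⟩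

theorem skip (h : ∀ m, P m → Q m) : Triple P .skip 1 Q :=
  fun m hm => ⟨m, 1, .skip m, le_rfl, h m hm⟩

theorem assign {x : ℕ} {e : Expr} (h : ∀ m, P m → Q (m.setReg x (e.eval m))) :
    Triple P (.assign x e) (e.cost + 1) Q :=
  fun m hm => ⟨_, _, .assign x e m, le_rfl, h m hm⟩

theorem store {a : ℕ} {i e : Expr} (h : ∀ m, P m → Q (m.setArr a (i.eval m) (e.eval m))) :
    Triple P (.store a i e) (i.cost + e.cost + 1) Q :=
  fun m hm => ⟨_, _, .store a i e m, le_rfl, h m hm⟩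

theorem seq (hp : Triple P p T Q) (hq : Triple Q q T' R) :
    Triple P (.seq p q) (T + T') R := fun m hm => by
  obtain ⟨m', t, h₁, h₂, h₃⟩ := hp m hm
  obtain ⟨m'', t', h₄, h₅, h₆⟩ := hq m' h₃
  exact ⟨m'', t + t', .seq h₁ h₄, by omega, h₆⟩

theorem branch {e : Expr} (hp : Triple (fun m => P m ∧ e.eval m ≠ 0) p T Q)
    (hq : Triple (fun m => P m ∧ e.eval m = 0) q T' Q) :
    Triple P (.branch e p q) (e.cost + 1 + (T + T')) Q := fun m hm => by
  by_cases he : e.eval m = 0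
  · obtain ⟨m', t, h₁, h₂, h₃⟩ := hq m ⟨hm, he⟩
    exact ⟨m', _, .branch_false he h₁, by omega, h₃⟩
  · obtain ⟨m', t, h₁, h₂, h₃⟩ := hp m ⟨hm, he⟩
    exact ⟨m', _, .branch_true he h₁, by omega, h₃⟩

end Triple

/-- Execute the body with register `r` running over all numbers less than the bound. -/
def Program.forLoop (r : ℕ) (bound : Expr) (body : Program) : Program :=
  .seq (.assign r (.const 0))
    (.loop (.minus bound (.reg r)) (.seq body (.assign r (.plus (.reg r) (.const 1)))))

/-- `I v` holds at the start of the round with `r = v`. A round costs the body, the test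
(`bound.cost + 3`) and the increment (`4`); initialisation and the last test account for `bound.cost
+ 5`. -/
theorem Triple.forLoop {P : Memory → Prop} {r : ℕ} {bound : Expr} {body : Program} {B T : ℕ}
    (I : ℕ → Memory → Prop) (h₀ : ∀ m, P m → I 0 (m.setReg r 0))
    (hI : ∀ v ≤ B, ∀ m, I v m → m.reg r = v ∧ bound.eval m = B)
    (hbody : ∀ v < B, Triple (I v) body T fun m => m.reg r = v ∧ I (v + 1) (m.setReg r (v + 1))) :
    Triple P (.forLoop r bound body) (B * (T + (bound.cost + 7)) + (bound.cost + 5)) (I B) := by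
  have hloop : ∀ w v, v + w = B → Triple (I v)
      (.loop (.minus bound (.reg r)) (.seq body (.assign r (.plus (.reg r) (.const 1)))))
      (w * (T + (bound.cost + 7)) + (bound.cost + 3)) (I B) := by
    intro w
    induction w with
    | zero =>
      rintro v rfl m hm
      obtain ⟨h₁, h₂⟩ := hI v le_rfl m hm
      refine ⟨m, (Expr.minus bound (.reg r)).cost + 1, ?_, ?_, hm⟩
      · constructor
        simp [Expr.eval, h₁, h₂]
      · simp [Expr.cost]
    | succ w ih =>
      intro v hv m hm
      obtain ⟨h₁, h₂⟩ := hI v (by omega) m hm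
      obtain ⟨m', t, h₃, h₄, h₅, h₆⟩ := hbody v (by omega) m hm
      have h₇ : m'.setReg r ((Expr.plus (.reg r) (.const 1)).eval m') = m'.setReg r (v + 1) := by
        simp [Expr.eval, h₅]
      obtain ⟨m'', t', h₈, h₉, h₁₀⟩ := ih (v + 1) (by omega) _ h₆
      refine ⟨m'', _, .loop_step ?_ (.seq h₃ (.assign _ _ _)) (h₇ ▸ h₈), ?_, h₁₀⟩
      · simp only [Expr.eval, h₁, h₂]; omega
      · simp only [Expr.cost]
        rw [Nat.succ_mul]
        omega
  have h := (Triple.assign (Q := I 0) (x := r) (e := .const 0) h₀).seq (hloop B 0 (by omega))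
  exact h.conseq (fun _ h => h) (by simp only [Expr.cost]; omega) fun _ h => h

/-! ### Nested loops as a counter in base `B` -/

/-- The `i`-th digit of `C` in base `B`. -/
def digit (B C i : ℕ) : ℕ := C / B ^ i % B

/-- Execute the body for all values less than `n + 1` of the registers `rg 0, …, rg (j - 1)`, where
`n` is the content of register `0`. -/
def Program.nest (rg : ℕ → ℕ) : ℕ → Program → Program
  | 0, body => body
  | j + 1, body => .forLoop (rg j) (.plus (.reg 0) (.const 1)) (nest rg j body)

/-- The running time of nested loops. -/
def nestTime {R : Type*} [Semiring R] (B T : R) : ℕ → R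
  | 0 => T
  | j + 1 => B * (nestTime B T j + 10) + 8

theorem digit_add_mul_of_lt {B C v i j : ℕ} (hij : i < j) :
    digit B (C + v * B ^ j) i = digit B C i := by
  unfold digit
  rcases Nat.eq_zero_or_pos B with rfl | hB
  · have : (0 : ℕ) ^ j = 0 := zero_pow (by omega)
    simp [this]
  · obtain ⟨l, rfl⟩ := Nat.exists_eq_add_of_lt hij
    have e : C + v * B ^ (i + l + 1) = C + v * B ^ l * B * B ^ i := by ring
    rw [e, Nat.add_mul_div_right _ _ (Nat.pow_pos hB), Nat.add_mul_mod_self_right]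

theorem digit_add_mul_self {B C v j : ℕ} (hC : B ^ (j + 1) ∣ C) (hv : v < B) :
    digit B (C + v * B ^ j) j = v := by
  unfold digit
  obtain ⟨w, rfl⟩ := hC
  have e : B ^ (j + 1) * w + v * B ^ j = (v + w * B) * B ^ j := by ring
  rw [e, Nat.mul_div_cancel _ (Nat.pow_pos (by omega)), Nat.add_mul_mod_self_right,
    Nat.mod_eq_of_lt hv]

theorem digit_add_mul_of_gt {B C v i j : ℕ} (hC : B ^ (j + 1) ∣ C) (hv : v < B) (hij : j < i) :
    digit B (C + v * B ^ j) i = digit B C i := by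
  unfold digit
  obtain ⟨w, rfl⟩ := hC
  obtain ⟨l, rfl⟩ := Nat.exists_eq_add_of_lt hij
  have hB : 0 < B ^ (j + 1) := Nat.pow_pos (by omega)
  have hlt : v * B ^ j < B ^ (j + 1) := by
    rw [pow_succ, mul_comm]; exact Nat.mul_lt_mul_of_pos_left hv (Nat.pow_pos (by omega))
  have e : j + l + 1 = (j + 1) + l := by omega
  rw [e, pow_add B (j + 1) l, ← Nat.div_div_eq_div_mul, ← Nat.div_div_eq_div_mul, Nat.mul_add_div hB,
    Nat.div_eq_of_lt hlt, Nat.mul_div_cancel_left _ hB, add_zero]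

theorem digit_le {n : ℕ} (C i : ℕ) : digit (n + 1) C i ≤ n :=
  Nat.le_of_lt_succ (Nat.mod_lt _ (Nat.succ_pos n))

theorem exists_digits {n : ℕ} (σ : ℕ → ℕ) (hσ : ∀ i, σ i ≤ n) (K : ℕ) :
    ∃ C < (n + 1) ^ K, ∀ i < K, digit (n + 1) C i = σ i := by
  induction K with
  | zero => exact ⟨0, by simp, by simp⟩
  | succ K ih =>
    obtain ⟨C, hC, h⟩ := ih
    refine ⟨C + σ K * (n + 1) ^ K, ?_, fun i hi => ?_⟩
    · have := Nat.mul_le_mul_right ((n + 1) ^ K) (hσ K)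
      rw [pow_succ, Nat.mul_succ, mul_comm _ n]
      omega
    · rcases (show i ≤ K by omega).eq_or_lt with rfl | hlt
      · unfold digit
        rw [Nat.add_mul_div_right _ _ (Nat.pow_pos (Nat.succ_pos n)), Nat.div_eq_of_lt hC, zero_add,
          Nat.mod_eq_of_lt (Nat.lt_succ_of_le (hσ i))]
      · rw [digit_add_mul_of_lt hlt, h i hlt]

/-- The outermost loop runs over the most significant digit, so the codes `C` occur in increasing
order. A register incremented in the body thus holds the code without any multiplication. -/
theorem Triple.nest {rg : ℕ → ℕ} (hrg : Function.Injective rg) {K B T : ℕ} {body : Program}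
    (I : ℕ → Memory → Prop) (hB : ∀ C m, I C m → m.reg 0 + 1 = B)
    (hI : ∀ C m i v, I C m → I C (m.setReg (rg i) v))
    (hbody : ∀ C < B ^ K, Triple (fun m => I C m ∧ ∀ i < K, m.reg (rg i) = digit B C i) body T
      fun m => I (C + 1) m ∧ ∀ i < K, m.reg (rg i) = digit B C i) :
    Triple (I 0) (.nest rg K body) (nestTime B T K) (I (B ^ K)) := by
  -- The inner `j` loops treat the block of codes from `C` to `C + B ^ j - 1`, which share all
  -- digits from the `j`-th on.
  have key : ∀ j ≤ K, ∀ C, B ^ j ∣ C → C + B ^ j ≤ B ^ K →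
      Triple (fun m => I C m ∧ ∀ i, j ≤ i → i < K → m.reg (rg i) = digit B C i)
        (.nest rg j body) (nestTime B T j)
        fun m => I (C + B ^ j) m ∧ ∀ i, j ≤ i → i < K → m.reg (rg i) = digit B C i := by
    intro j
    induction j with
    | zero =>
      intro _ C _ hC
      rw [pow_zero] at hC
      refine (hbody C (by omega)).conseq ?_ le_rfl ?_
      · exact fun m hm => ⟨hm.1, fun i hi => hm.2 i (Nat.zero_le i) hi⟩
      · exact fun m hm => ⟨hm.1, fun i _ hi => hm.2 i hi⟩
    | succ j ih =>
      intro hj C hC hle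
      have hCj : B ^ j ∣ C := (pow_dvd_pow B (Nat.le_succ j)).trans hC
      let I' : ℕ → Memory → Prop := fun v m => I (C + v * B ^ j) m ∧ m.reg (rg j) = v ∧
        ∀ i, j + 1 ≤ i → i < K → m.reg (rg i) = digit B C i
      have hne : ∀ i, j + 1 ≤ i → rg i ≠ rg j := fun i hi h => by
        have := hrg h; omega
      have h := Triple.forLoop (P := fun m => I C m ∧ ∀ i, j + 1 ≤ i → i < K →
          m.reg (rg i) = digit B C i) (r := rg j) (bound := .plus (.reg 0) (.const 1))
        (body := .nest rg j body) (B := B) (T := nestTime B T j) I' ?_ ?_ ?_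
      · refine h.conseq (fun _ h => h) le_rfl fun m hm => ?_
        rw [pow_succ']
        exact ⟨hm.1, hm.2.2⟩
      · intro m hm
        refine ⟨by simpa using hI _ _ _ _ hm.1, by simp, fun i h₁ h₂ => ?_⟩
        rw [Memory.reg_setReg, if_neg (hne i h₁)]
        exact hm.2 i h₁ h₂
      · exact fun v _ m hm => ⟨hm.2.1, hB _ m hm.1⟩
      · intro v hv
        have hpow : v * B ^ j + B ^ j ≤ B ^ (j + 1) := by
          rw [← Nat.succ_mul, pow_succ']; exact Nat.mul_le_mul_right _ hv
        refine (ih (by omega) (C + v * B ^ j) (Dvd.dvd.add hCj (Dvd.intro_left v rfl))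
          (by omega)).conseq ?_ le_rfl ?_
        · rintro m ⟨h₁, h₂, h₃⟩
          refine ⟨h₁, fun i hji hi => ?_⟩
          rcases hji.eq_or_lt with rfl | hlt
          · rw [h₂, digit_add_mul_self hC hv]
          · rw [h₃ i hlt hi, digit_add_mul_of_gt hC hv hlt]
        · rintro m ⟨h₁, h₂⟩
          refine ⟨?_, ?_, by simp, fun i hji hi => ?_⟩
          · rw [h₂ j le_rfl (by omega), digit_add_mul_self hC hv]
          · rw [Nat.succ_mul, ← add_assoc]
            exact hI _ _ _ _ h₁
          · rw [Memory.reg_setReg, if_neg (hne i hji), h₂ i (by omega) hi,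
              digit_add_mul_of_gt hC hv (by omega)]
  refine (key K le_rfl 0 (dvd_zero _) (by omega)).conseq ?_ le_rfl ?_
  · exact fun m hm => ⟨hm, fun i h₁ h₂ => by omega⟩
  · exact fun m hm => by simpa using hm.1

end Machine

/-! ### Searching the graph of states -/

section Search

open Polynomial

/-- The numbers less than `N` that can be reached in exactly `j` steps. -/
def ReachedIn (init : ℕ → Prop) (St : ℕ → ℕ → Prop) (N : ℕ) : ℕ → ℕ → Prop
  | 0, C => C < N ∧ init C
  | j + 1, C' => C' < N ∧ ∃ C, ReachedIn init St N j C ∧ St C C'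

theorem ReachedIn.lt {init : ℕ → Prop} {St : ℕ → ℕ → Prop} {N j C : ℕ}
    (h : ReachedIn init St N j C) : C < N := by
  cases j <;> exact h.1

/-- The marks during round `i` of the search: all that can be reached in `i` steps is marked, and
the pairs before `(C₁, C₂)` have been treated. -/
structure Marks (init : ℕ → Prop) (St : ℕ → ℕ → Prop) (N i C₁ C₂ : ℕ) (vis : ℕ → ℕ) : Prop where
  sound : ∀ C, vis C ≠ 0 → ∃ j, ReachedIn init St N j C
  old : ∀ j ≤ i, ∀ C, ReachedIn init St N j C → vis C ≠ 0
  new : ∀ C C', ReachedIn init St N i C → C' < N → St C C' → (C < C₁ ∨ C = C₁ ∧ C' < C₂) →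
    vis C' ≠ 0

namespace Marks

variable {init : ℕ → Prop} {St : ℕ → ℕ → Prop} {N i C₁ C₂ : ℕ} {vis : ℕ → ℕ}

theorem start (h : ∀ C, vis C ≠ 0 ↔ C < N ∧ init C) : Marks init St N 0 0 0 vis where
  sound C hC := ⟨0, (h C).1 hC⟩
  old j hj C hC := by
    obtain rfl : j = 0 := by omega
    exact (h C).2 hC
  new C C' _ _ _ h := by omega

theorem next_round (h : Marks init St N i N 0 vis) : Marks init St N (i + 1) 0 0 vis where
  sound := h.sound
  old j hj C hC := by
    rcases hj.eq_or_lt with rfl | hlt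
    · obtain ⟨h₁, C', h₂, h₃⟩ := hC
      exact h.new C' C h₂ h₁ h₃ (Or.inl h₂.lt)
    · exact h.old j (by omega) C hC
  new C C' _ _ _ h := by omega

theorem next_row (h : Marks init St N i C₁ N vis) : Marks init St N i (C₁ + 1) 0 vis where
  sound := h.sound
  old := h.old
  new C C' h₁ h₂ h₃ h₄ := h.new C C' h₁ h₂ h₃ (by omega)

/-- A mark set in this round may be used again in the same round. Soundness therefore asserts
reachability in some number of steps, not in a given one. -/
theorem next_of_update (h : Marks init St N i C₁ C₂ vis) (hC₂ : C₂ < N) (hv : vis C₁ ≠ 0)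
    (hs : St C₁ C₂) : Marks init St N i C₁ (C₂ + 1) (Function.update vis C₂ 1) where
  sound C hC := by
    by_cases e : C = C₂
    · subst e
      obtain ⟨j, hj⟩ := h.sound C₁ hv
      exact ⟨j + 1, hC₂, C₁, hj, hs⟩
    · rw [Function.update_of_ne e] at hC
      exact h.sound C hC
  old j hj C hC := by
    by_cases e : C = C₂
    · subst e; simp
    · rw [Function.update_of_ne e]
      exact h.old j hj C hC
  new C C' h₁ h₂ h₃ h₄ := by
    by_cases e : C' = C₂
    · subst e; simp
    · rw [Function.update_of_ne e]
      exact h.new C C' h₁ h₂ h₃ (by omega)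

theorem next_of_not (h : Marks init St N i C₁ C₂ vis) (hs : ¬ (vis C₁ ≠ 0 ∧ St C₁ C₂)) :
    Marks init St N i C₁ (C₂ + 1) vis where
  sound := h.sound
  old := h.old
  new C C' h₁ h₂ h₃ h₄ := by
    by_cases e : C = C₁ ∧ C' = C₂
    · obtain ⟨rfl, rfl⟩ := e
      exact absurd ⟨h.old i le_rfl C h₁, h₃⟩ hs
    · exact h.new C C' h₁ h₂ h₃ (by omega)

end Marks

/-- Since `nestTime` makes sense in any semiring, the same recursion gives the running time and the
polynomial bounding it. -/
theorem eval_nestTime (f g : ℕ[X]) (n K : ℕ) :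
    (nestTime f g K).eval n = nestTime (f.eval n) (g.eval n) K := by
  induction K with
  | zero => rfl
  | succ K ih => simp [nestTime, ih]

theorem Memory.reg_setReg_of_ne {μ : Memory} {x y v : ℕ} (h : y ≠ x) :
    (μ.setReg x v).reg y = μ.reg y := by
  simp [h]

/-- Register `0` holds `n`, and the first four arrays are `A 0, …, A 3`. -/
structure Ctx (n : ℕ) (A : ℕ → ℕ → ℕ) (μ : Memory) : Prop where
  reg : μ.reg 0 = n
  arr : ∀ a < 4, μ.arr a = A a

theorem Ctx.setReg {n : ℕ} {A : ℕ → ℕ → ℕ} {μ : Memory} (h : Ctx n A μ) {x v : ℕ} (hx : x ≠ 0) :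
    Ctx n A (μ.setReg x v) :=
  ⟨by rw [Memory.reg_setReg_of_ne hx.symm, h.reg], h.arr⟩

theorem Ctx.setArr {n : ℕ} {A : ℕ → ℕ → ℕ} {μ : Memory} (h : Ctx n A μ) {i v : ℕ} :
    Ctx n A (μ.setArr 4 i v) :=
  ⟨h.reg, fun a ha => by
    rw [Memory.arr_setArr, if_neg (by omega), h.arr a ha]⟩

/-- Increment a register. -/
def Program.incr (x : ℕ) : Program := .assign x (.plus (.reg x) (.const 1))

theorem Triple.incr {P Q : Memory → Prop} {x : ℕ} (h : ∀ μ, P μ → Q (μ.setReg x (μ.reg x + 1))) :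
    Triple P (.incr x) 4 Q :=
  Triple.assign h

section Expressions

/-- The adjacency of `x` and `z`; array `3` holds the multiples of the number of vertices. -/
def Expr.edge (x z : Expr) : Expr := .read 0 (.plus (.read 3 x) z)

/-- The vertex `z` is safe for the state in the registers `rg`. -/
def Expr.safe (k c m M : ℕ) (rg : ℕ → ℕ) (z : Expr) : Expr :=
  .and (.all (k * c) fun i => .neg (.equal (.reg (rg (k + i))) z))
    (.or (.sum M fun i => .equal (.reg (rg (k + k * c + i))) z)
      (.all k fun p => .less (.sum c fun i => .edge (.reg (rg (k + (p * c + i)))) z) (.const m)))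

/-- Some path is extended properly. -/
def Expr.extend (k c m M : ℕ) (rg rg' : ℕ → ℕ) : Expr :=
  .sum k fun p =>
    .and (.or (.and (.equal (.reg (rg p)) (.reg 0)) (.equal (.reg (rg' p)) (.read 1 (.const p))))
        (.edge (.reg (rg p)) (.reg (rg' p))))
      (.and (.less (.reg (rg' p)) (.reg 0))
        (.and (.all k fun q => if q = p then .const 1 else .equal (.reg (rg' q)) (.reg (rg q)))
          (.and (.safe k c m M rg (.reg (rg' p))) (.neg (.safe k c m M rg' (.reg (rg' p)))))))

theorem Safe.congr {k c m M : ℕ} {E : ℕ → ℕ → ℕ} {σ τ : ℕ → ℕ} {z : ℕ}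
    (h : ∀ i < k + k * c + M, σ i = τ i) (hs : Safe k c m M E σ z) : Safe k c m M E τ z := by
  obtain ⟨h₁, h₂⟩ := hs
  refine ⟨fun i hi => ?_, ?_⟩
  · rw [← h _ (by omega)]
    exact h₁ i hi
  · rcases h₂ with ⟨i, hi, h₂⟩ | h₂
    · exact Or.inl ⟨i, hi, by rw [← h _ (by omega)]; exact h₂⟩
    · refine Or.inr fun p hp => ?_
      have hpc : p * c + c ≤ k * c := by
        rw [← Nat.succ_mul]; exact Nat.mul_le_mul_right c hp
      convert h₂ p hp using 1
      refine Finset.sum_congr rfl fun i hi => ?_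
      rw [Finset.mem_range] at hi
      rw [h _ (by omega)]

theorem safe_congr {k c m M : ℕ} {E : ℕ → ℕ → ℕ} {σ τ : ℕ → ℕ} {z : ℕ}
    (h : ∀ i < k + k * c + M, σ i = τ i) : Safe k c m M E σ z ↔ Safe k c m M E τ z :=
  ⟨Safe.congr h, Safe.congr fun i hi => (h i hi).symm⟩

theorem step_congr {k c m M n : ℕ} {E : ℕ → ℕ → ℕ} {S : ℕ → ℕ} {σ σ' τ τ' : ℕ → ℕ}
    (h : ∀ i < k + k * c + M, σ i = σ' i) (h' : ∀ i < k + k * c + M, τ i = τ' i) :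
    Step k c m M n E S σ τ ↔ Step k c m M n E S σ' τ' := by
  have hk : ∀ p < k, p < k + k * c + M := fun p hp => by omega
  refine and_congr (exists_congr fun p => and_congr_right fun hp => ?_)
    (forall₂_congr fun z _ => by rw [safe_congr h, safe_congr h'])
  rw [h p (hk p hp), h' p (hk p hp), safe_congr h, safe_congr h']
  refine and_congr_right fun _ => and_congr_right fun _ => and_congr_left fun _ =>
    forall₃_congr fun q hq _ => by rw [h q (hk q hq), h' q (hk q hq)]

variable {k c m M n : ℕ} {A : ℕ → ℕ → ℕ} {μ : Memory}

theorem Ctx.eval_edge (h : Ctx n A μ) (x z : Expr) :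
    (Expr.edge x z).eval μ = A 0 (A 3 (x.eval μ) + z.eval μ) := by
  simp [Expr.edge, Expr.eval, h.arr]

theorem Ctx.eval_safe (h : Ctx n A μ) (rg : ℕ → ℕ) (z : Expr) :
    (Expr.safe k c m M rg z).eval μ ≠ 0 ↔
      Safe k c m M (fun u v => A 0 (A 3 u + v)) (fun j => μ.reg (rg j)) (z.eval μ) := by
  simp only [Expr.safe, Expr.eval_and_ne_zero, Expr.eval_all_ne_zero, Expr.eval_or_ne_zero,
    Expr.eval_sum_ne_zero, Expr.eval_neg_ne_zero, Expr.eval_equal_ne_zero, Expr.eval_less_ne_zero,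
    Expr.eval, Safe]
  simp only [Expr.eval_sum, h.eval_edge, Expr.eval, ne_eq]

/-- An expression has fixed size, so the quantifier over all `z < n` cannot be part of it; a loop
evaluates it into register `5`. -/
theorem Ctx.eval_extend (h : Ctx n A μ) (rg rg' : ℕ → ℕ) :
    ((Expr.extend k c m M rg rg').eval μ ≠ 0 ∧
      ∀ z < n, Safe k c m M (fun u v => A 0 (A 3 u + v)) (fun j => μ.reg (rg' j)) z →
        Safe k c m M (fun u v => A 0 (A 3 u + v)) (fun j => μ.reg (rg j)) z) ↔
      Step k c m M n (fun u v => A 0 (A 3 u + v)) (A 1) (fun j => μ.reg (rg j))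
        (fun j => μ.reg (rg' j)) := by
  refine and_congr_left fun _ => ?_
  simp only [Expr.extend, Expr.eval_and_ne_zero, Expr.eval_all_ne_zero, Expr.eval_or_ne_zero,
    Expr.eval_sum_ne_zero, Expr.eval_neg_ne_zero, Expr.eval_equal_ne_zero, Expr.eval_less_ne_zero,
    h.eval_edge, h.eval_safe, Expr.eval, h.reg, h.arr 1 (by omega)]
  refine exists_congr fun p => and_congr_right fun _ => and_congr_right fun _ =>
    and_congr_right fun _ => and_congr_left fun _ => forall₂_congr fun q _ => ?_
  by_cases hq : q = p
  · simp [hq, Expr.eval]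
  · simp [hq, Expr.eval_equal_ne_zero, Expr.eval]

end Expressions

/-! ### The program -/

/-- The registers of the first state. -/
def regA (j : ℕ) : ℕ := 8 + 2 * j

/-- The registers of the second state. -/
def regB (j : ℕ) : ℕ := 9 + 2 * j

/-- If vertex `z` in register `4` is safe for the second state, then also for the first one; and
the same is true for the previous vertices, as register `5` says. -/
def Expr.keepsSafe (k c m M : ℕ) : Expr :=
  .and (.reg 5) (.or (.neg (.safe k c m M regB (.reg 4))) (.safe k c m M regA (.reg 4)))

/-- The first state is marked, and there is a step from it to the second state. -/
def Expr.marksNext (k c m M : ℕ) : Expr :=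
  .and (.read 4 (.reg 2)) (.and (.reg 5) (.extend k c m M regA regB))

/-- The state is initial. -/
def Expr.initial (k : ℕ) : Expr := .all k fun p => .equal (.reg (regA p)) (.reg 0)

/-- The state is marked, and final. -/
def Expr.markedFinal (k : ℕ) : Expr :=
  .and (.read 4 (.reg 2)) (.all k fun p => .equal (.reg (regA p)) (.read 2 (.const p)))

/-- Mark the second state if there is a step to it from the first one, and that one is marked. -/
def relax (k c m M : ℕ) : Program :=
  .seq (.assign 5 (.const 1))
    (.seq
      (.forLoop 4 (.reg 0) (.assign 5 (.keepsSafe k c m M)))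
      (.seq (.branch (.marksNext k c m M) (.store 4 (.reg 3) (.const 1)) .skip) (.incr 3)))

/-- Treat all pairs of states. -/
def sweep (k c m M : ℕ) : Program :=
  .seq (.assign 2 (.const 0))
    (.nest regA (k + k * c + M)
      (.seq (.seq (.assign 3 (.const 0)) (.nest regB (k + k * c + M) (relax k c m M))) (.incr 2)))

/-- Compute the multiples of the number of vertices. -/
def multiples : Program :=
  .seq (.assign 7 (.const 0))
    (.forLoop 4 (.plus (.reg 0) (.const 1))
      (.seq (.store 3 (.reg 4) (.reg 7)) (.assign 7 (.plus (.reg 7) (.reg 0)))))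

/-- Mark the initial states. -/
def markInitial (k c M : ℕ) : Program :=
  .seq (.assign 2 (.const 0))
    (.nest regA (k + k * c + M)
      (.seq (.branch (.initial k) (.store 4 (.reg 2) (.const 1)) .skip) (.incr 2)))

/-- Find out whether a final state is marked. -/
def findFinal (k c M : ℕ) : Program :=
  .seq (.seq (.assign 6 (.const 0)) (.assign 2 (.const 0)))
    (.seq
      (.nest regA (k + k * c + M)
        (.seq (.branch (.markedFinal k) (.assign 6 (.const 1)) .skip) (.incr 2)))
      (.assign 0 (.neg (.neg (.reg 6)))))

/-- The whole algorithm. -/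
def solver (k c m M : ℕ) : Program :=
  .seq multiples (.seq (markInitial k c M)
    (.seq (.forLoop 1 (.reg 0) (sweep k c m M)) (findFinal k c M)))

/-- The code `C` is that of an initial state. -/
def IsInitial (k n C : ℕ) : Prop := ∀ p < k, digit (n + 1) C p = n

/-- There is a step between the states with codes `C` and `C'`. -/
def CodeStep (k c m M n : ℕ) (A : ℕ → ℕ → ℕ) (C C' : ℕ) : Prop :=
  Step k c m M n (fun u v => A 0 (A 3 u + v)) (A 1) (digit (n + 1) C) (digit (n + 1) C')

/-- The memory before round `i` of the search or within it, when the pairs of codes before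
`(C₁, C₂)` have been treated. -/
structure Round (k c m M n : ℕ) (A : ℕ → ℕ → ℕ) (i C₁ C₂ : ℕ) (μ : Memory) : Prop where
  ctx : Ctx n A μ
  round : μ.reg 1 = i
  marks : Marks (IsInitial k n) (CodeStep k c m M n A) ((n + 1) ^ (k + k * c + M)) i C₁ C₂ (μ.arr 4)

theorem Round.setReg {k c m M n : ℕ} {A : ℕ → ℕ → ℕ} {i C₁ C₂ : ℕ} {μ : Memory}
    (h : Round k c m M n A i C₁ C₂ μ) {x v : ℕ} (hx : 2 ≤ x) :
    Round k c m M n A i C₁ C₂ (μ.setReg x v) :=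
  ⟨h.ctx.setReg (by omega), by rw [Memory.reg_setReg_of_ne (by omega), h.round], h.marks⟩

/-- The memory while the pair of codes `(C₁, C₂)` is treated. -/
structure Row (k c m M n : ℕ) (A : ℕ → ℕ → ℕ) (i C₁ C₂ : ℕ) (μ : Memory) : Prop where
  toRound : Round k c m M n A i C₁ C₂ μ
  code₁ : μ.reg 2 = C₁
  code₂ : μ.reg 3 = C₂
  digits : ∀ j < k + k * c + M, μ.reg (regA j) = digit (n + 1) C₁ j

theorem Row.setReg {k c m M n : ℕ} {A : ℕ → ℕ → ℕ} {i C₁ C₂ : ℕ} {μ : Memory}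
    (h : Row k c m M n A i C₁ C₂ μ) {x v : ℕ} (hx : 4 ≤ x) (hx' : ∀ j, regA j ≠ x) :
    Row k c m M n A i C₁ C₂ (μ.setReg x v) :=
  ⟨h.toRound.setReg (by omega), by rw [Memory.reg_setReg_of_ne (by omega), h.code₁],
    by rw [Memory.reg_setReg_of_ne (by omega), h.code₂], fun j hj => by
      rw [Memory.reg_setReg_of_ne (hx' j), h.digits j hj]⟩

theorem relax_triple (k c m M : ℕ) : ∃ f : ℕ[X], ∀ n A i C₁ C₂,
    C₂ < (n + 1) ^ (k + k * c + M) →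
    Triple
      (fun μ => Row k c m M n A i C₁ C₂ μ ∧
        ∀ j < k + k * c + M, μ.reg (regB j) = digit (n + 1) C₂ j)
      (relax k c m M) (f.eval n)
      (fun μ => Row k c m M n A i C₁ (C₂ + 1) μ ∧
        ∀ j < k + k * c + M, μ.reg (regB j) = digit (n + 1) C₂ j) := by
  refine ⟨2 + ((X * (C ((Expr.keepsSafe k c m M).cost + 1) + 8) + 6) +
    (C ((Expr.marksNext k c m M).cost + 1) + 4 + 4)), fun n A i C₁ C₂ hC₂ => ?_⟩
  have hA : ∀ x, x < 8 → ∀ j, regA j ≠ x := fun x hx j => by unfold regA; omega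
  have hB : ∀ x, x < 8 → ∀ j, regB j ≠ x := fun x hx j => by unfold regB; omega
  simp only [eval_add, eval_mul, eval_X, eval_C, eval_ofNat]
  let E : ℕ → ℕ → ℕ := fun u v => A 0 (A 3 u + v)
  -- Register `5` records whether no vertex below `v` becomes safe.
  let J : ℕ → Memory → Prop := fun v μ => (Row k c m M n A i C₁ C₂ μ ∧
    ∀ j < k + k * c + M, μ.reg (regB j) = digit (n + 1) C₂ j) ∧
      (μ.reg 5 ≠ 0 ↔ ∀ z < v, Safe k c m M E (digit (n + 1) C₂) z →
        Safe k c m M E (digit (n + 1) C₁) z)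
  have hJ : ∀ x v w μ, x < 8 → 4 ≤ x → (Row k c m M n A i C₁ C₂ μ ∧
      ∀ j < k + k * c + M, μ.reg (regB j) = digit (n + 1) C₂ j) →
      (Row k c m M n A i C₁ C₂ (μ.setReg x v) ∧
        ∀ j < k + k * c + M, (μ.setReg x w).reg (regB j) = digit (n + 1) C₂ j) := by
    intro x v w μ hx hx' h
    exact ⟨h.1.setReg hx' (hA x hx), fun j hj => by
      rw [Memory.reg_setReg_of_ne (hB x hx j), h.2 j hj]⟩
  refine Triple.seq (Q := J 0) ?_ (Triple.seq (Q := J n) ?_ ?_)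
  · refine Triple.assign fun μ h => ⟨hJ _ _ _ _ (by omega) (by omega) h, ?_⟩
    simp [Expr.eval]
  · refine (Triple.forLoop (B := n) (fun v μ => J v μ ∧ μ.reg 4 = v) ?_ ?_ ?_).conseq
      (fun _ h => h) le_rfl fun μ h => h.1
    · exact fun μ h => ⟨⟨hJ _ _ _ _ (by omega) (by omega) h.1, by simpa using h.2⟩, by simp⟩
    · exact fun v _ μ h => ⟨h.2, h.1.1.1.toRound.ctx.reg⟩
    · intro v hv
      refine Triple.assign fun μ h => ?_
      obtain ⟨⟨h₁, h₂⟩, h₃⟩ := h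
      refine ⟨by simpa using h₃, ⟨hJ _ _ _ _ (by omega) (by omega)
        (hJ _ _ _ _ (by omega) (by omega) h₁), ?_⟩, by simp⟩
      have hctx := h₁.1.toRound.ctx
      rw [Memory.reg_setReg_of_ne (by omega), Memory.reg_setReg, if_pos rfl,
        Expr.keepsSafe, Expr.eval_and_ne_zero, Expr.eval_or_ne_zero, Expr.eval_neg_ne_zero,
        hctx.eval_safe, hctx.eval_safe, safe_congr h₁.2, safe_congr h₁.1.digits]
      simp only [Expr.eval, h₃]
      rw [h₂]
      constructor
      · rintro ⟨h₄, h₅⟩ z hz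
        rcases (show z ≤ v by omega).eq_or_lt with rfl | hlt
        · tauto
        · exact h₄ z hlt
      · exact fun h => ⟨fun z hz => h z (by omega), by have := h v (by omega); tauto⟩
  · refine Triple.seq (Q := fun μ => (Round k c m M n A i C₁ (C₂ + 1) μ ∧ μ.reg 2 = C₁ ∧
      μ.reg 3 = C₂ ∧ ∀ j < k + k * c + M, μ.reg (regA j) = digit (n + 1) C₁ j) ∧
        ∀ j < k + k * c + M, μ.reg (regB j) = digit (n + 1) C₂ j) ?_ (Triple.incr ?_)
    · have hev : ∀ μ, J n μ → ((Expr.marksNext k c m M).eval μ ≠ 0 ↔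
          μ.arr 4 C₁ ≠ 0 ∧ CodeStep k c m M n A C₁ C₂) := by
        rintro μ ⟨h₁, h₂⟩
        have hctx := h₁.1.toRound.ctx
        rw [Expr.marksNext, Expr.eval_and_ne_zero, Expr.eval_and_ne_zero, CodeStep,
          ← step_congr h₁.1.digits h₁.2, ← hctx.eval_extend]
        simp only [Expr.eval, h₁.1.code₁]
        rw [h₂]
        refine and_congr_right fun _ => and_comm.trans (and_congr_right fun _ =>
          forall₂_congr fun z _ => ?_)
        rw [safe_congr h₁.2, safe_congr h₁.1.digits]
      refine Triple.branch (Triple.store ?_) (Triple.skip ?_)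
      · rintro μ ⟨h, he⟩
        have hs := (hev μ h).1 he
        have h₁ := h.1.1
        refine ⟨⟨⟨h₁.toRound.ctx.setArr, h₁.toRound.round, ?_⟩, h₁.code₁, h₁.code₂, h₁.digits⟩,
          h.1.2⟩
        rw [Memory.arr_setArr, if_pos rfl]
        simp only [Expr.eval, h₁.code₂]
        exact h₁.toRound.marks.next_of_update hC₂ hs.1 hs.2
      · rintro μ ⟨h, he⟩
        have h₁ := h.1.1
        exact ⟨⟨⟨h₁.toRound.ctx, h₁.toRound.round, h₁.toRound.marks.next_of_not fun hs =>
          (hev μ h).2 hs he⟩, h₁.code₁, h₁.code₂, h₁.digits⟩, h.1.2⟩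
    · rintro μ ⟨⟨h₁, h₂, h₃, h₄⟩, h₅⟩
      refine ⟨⟨h₁.setReg (by omega), ?_, ?_, fun j hj => ?_⟩, fun j hj => ?_⟩
      · rw [Memory.reg_setReg_of_ne (by omega), h₂]
      · rw [Memory.reg_setReg, if_pos rfl, h₃]
      · rw [Memory.reg_setReg_of_ne (hA 3 (by omega) j), h₄ j hj]
      · rw [Memory.reg_setReg_of_ne (hB 3 (by omega) j), h₅ j hj]

theorem regA_injective : Function.Injective regA := fun i j h => by unfold regA at h; omega

theorem regB_injective : Function.Injective regB := fun i j h => by unfold regB at h; omega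

theorem sweep_triple (k c m M : ℕ) : ∃ f : ℕ[X], ∀ n A i,
    Triple (Round k c m M n A i 0 0) (sweep k c m M) (f.eval n)
      (fun μ => Round k c m M n A i 0 0 μ ∧
        Marks (IsInitial k n) (CodeStep k c m M n A) ((n + 1) ^ (k + k * c + M)) (i + 1) 0 0
          (μ.arr 4)) := by
  obtain ⟨f, hf⟩ := relax_triple k c m M
  refine ⟨2 + nestTime (X + 1) (2 + nestTime (X + 1) f (k + k * c + M) + 4) (k + k * c + M),
    fun n A i => ?_⟩
  simp only [eval_add, eval_nestTime, eval_X, eval_ofNat, eval_one]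
  have hA : ∀ x, x < 8 → ∀ j, regA j ≠ x := fun x hx j => by unfold regA; omega
  have hB : ∀ j, 8 ≤ regB j := fun j => by unfold regB; omega
  have hAB : ∀ i j, regA i ≠ regB j := fun i j => by unfold regA regB; omega
  refine Triple.seq (Q := fun μ => Round k c m M n A i 0 0 μ ∧ μ.reg 2 = 0)
    (Triple.assign fun μ h => ⟨h.setReg (by omega), by simp [Expr.eval]⟩) ?_
  refine (Triple.nest regA_injective (B := n + 1)
    (fun C μ => Round k c m M n A i C 0 μ ∧ μ.reg 2 = C) ?_ ?_ ?_).conseq (fun _ h => h) le_rfl ?_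
  · exact fun C μ h => by rw [h.1.ctx.reg]
  · intro C μ j v h
    have : 8 ≤ regA j := by unfold regA; omega
    exact ⟨h.1.setReg (by omega), by rw [Memory.reg_setReg_of_ne (by omega), h.2]⟩
  · intro C hC
    refine Triple.seq (Q := fun μ => Row k c m M n A i C ((n + 1) ^ (k + k * c + M)) μ)
      (Triple.seq (Q := fun μ => Row k c m M n A i C 0 μ) (Triple.assign ?_) ?_) (Triple.incr ?_)
    · rintro μ ⟨⟨h₁, h₂⟩, h₃⟩
      exact ⟨h₁.setReg (by omega), by rw [Memory.reg_setReg_of_ne (by omega), h₂],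
        by simp [Expr.eval], fun j hj => by
          rw [Memory.reg_setReg_of_ne (hA 3 (by omega) j), h₃ j hj]⟩
    · refine Triple.nest regB_injective (B := n + 1) (fun C' μ => Row k c m M n A i C C' μ) ?_ ?_ ?_
      · exact fun C' μ h => by rw [h.toRound.ctx.reg]
      · exact fun C' μ j v h => h.setReg (by have := hB j; omega) fun j' => hAB j' j
      · exact fun C' hC' => hf n A i C C' hC'
    · intro μ h
      refine ⟨⟨⟨h.toRound.ctx.setReg (by omega), ?_, h.toRound.marks.next_row⟩, ?_⟩, fun j hj => ?_⟩
      · rw [Memory.reg_setReg_of_ne (by omega), h.toRound.round]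
      · rw [Memory.reg_setReg, if_pos rfl, h.code₁]
      · rw [Memory.reg_setReg_of_ne (hA 2 (by omega) j), h.digits j hj]
  · rintro μ ⟨h, -⟩
    have hm := h.marks.next_round
    -- The marks are already those of round `i + 1`, but register `1` still holds `i` until the
    -- enclosing loop increments it. Both facts are therefore returned.
    exact ⟨⟨h.ctx, h.round, hm.sound, fun j hj => hm.old j (by omega), fun C C' _ _ _ h => by omega⟩,
      hm⟩

theorem sweeps_triple (k c m M : ℕ) : ∃ f : ℕ[X], ∀ n A,
    Triple (fun μ => Ctx n A μ ∧ ∀ C, μ.arr 4 C ≠ 0 ↔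
        C < (n + 1) ^ (k + k * c + M) ∧ IsInitial k n C)
      (.forLoop 1 (.reg 0) (sweep k c m M)) (f.eval n) (Round k c m M n A n 0 0) := by
  obtain ⟨f, hf⟩ := sweep_triple k c m M
  refine ⟨X * (f + 8) + 6, fun n A => ?_⟩
  simp only [eval_add, eval_mul, eval_X, eval_ofNat]
  refine Triple.forLoop (Round k c m M n A · 0 0) ?_ ?_ ?_
  · exact fun μ h => ⟨h.1.setReg (by omega), by simp, Marks.start h.2⟩
  · exact fun v _ μ h => ⟨h.round, h.ctx.reg⟩
  · exact fun v _ => (hf n A v).conseq (fun _ h => h) le_rfl fun μ h =>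
      ⟨h.1.round, h.1.ctx.setReg (by omega), by simp, h.2⟩

theorem multiples_triple : ∃ f : ℕ[X], ∀ (n : ℕ) (A : ℕ → ℕ → ℕ),
    Triple (fun μ => μ.reg 0 = n ∧ μ.arr = A) multiples (f.eval n)
      (fun μ => μ.reg 0 = n ∧ (∀ a, a ≠ 3 → μ.arr a = A a) ∧ ∀ u ≤ n, μ.arr 3 u = u * n) := by
  refine ⟨2 + ((X + 1) * (7 + 10) + 8), fun n A => ?_⟩
  simp only [eval_add, eval_mul, eval_X, eval_ofNat, eval_one]
  refine Triple.seq (Q := fun μ => μ.reg 0 = n ∧ μ.arr = A ∧ μ.reg 7 = 0)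
    (Triple.assign fun μ h => ⟨by simpa using h.1, h.2, by simp [Expr.eval]⟩) ?_
  refine (Triple.forLoop (B := n + 1) (fun v μ => μ.reg 4 = v ∧ μ.reg 0 = n ∧ μ.reg 7 = v * n ∧
    (∀ a, a ≠ 3 → μ.arr a = A a) ∧ ∀ u < v, μ.arr 3 u = u * n) ?_ ?_ ?_).conseq (fun _ h => h)
    le_rfl ?_
  · rintro μ ⟨h₁, h₂, h₃⟩
    exact ⟨by simp, by simpa using h₁, by simpa using h₃, fun a _ => by simp [h₂], by simp⟩
  · rintro v _ μ ⟨h₁, h₂, -⟩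
    exact ⟨h₁, by simp [Expr.eval, h₂]⟩
  · intro v _
    refine Triple.seq (T := 3) (T' := 4) (Q := fun μ => μ.reg 4 = v ∧ μ.reg 0 = n ∧
      μ.reg 7 = v * n ∧ (∀ a, a ≠ 3 → μ.arr a = A a) ∧ ∀ u < v + 1, μ.arr 3 u = u * n)
      (Triple.store ?_) (Triple.assign ?_)
    · rintro μ ⟨h₁, h₂, h₃, h₄, h₅⟩
      refine ⟨h₁, h₂, h₃, fun a ha => ?_, fun u hu => ?_⟩
      · rw [Memory.arr_setArr, if_neg ha, h₄ a ha]
      · rw [Memory.arr_setArr, if_pos rfl, Function.update_apply]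
        simp only [Expr.eval, h₁]
        split_ifs with e
        · rw [h₃, e]
        · exact h₅ u (by omega)
    · rintro μ ⟨h₁, h₂, h₃, h₄, h₅⟩
      refine ⟨by simpa using h₁, by simp, by simpa using h₂, ?_, h₄, h₅⟩
      simp [Expr.eval, h₂, h₃, Nat.succ_mul]
  · rintro μ ⟨-, h₁, -, h₂, h₃⟩
    exact ⟨h₁, h₂, fun u hu => h₃ u (by omega)⟩

theorem markInitial_triple (k c M : ℕ) : ∃ f : ℕ[X], ∀ n A,
    Triple (fun μ => Ctx n A μ ∧ ∀ C, μ.arr 4 C = 0) (markInitial k c M) (f.eval n)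
      (fun μ => Ctx n A μ ∧ ∀ C, μ.arr 4 C ≠ 0 ↔
        C < (n + 1) ^ (k + k * c + M) ∧ IsInitial k n C) := by
  refine ⟨2 + nestTime (X + 1) (C ((Expr.initial k).cost + 1) + 4 + 4) (k + k * c + M), fun n A => ?_⟩
  simp only [eval_add, eval_nestTime, eval_X, eval_ofNat, eval_one, eval_C]
  have hA : ∀ j, 8 ≤ regA j := fun j => by unfold regA; omega
  refine Triple.seq (Q := fun μ => (Ctx n A μ ∧ ∀ C, μ.arr 4 C ≠ 0 ↔ C < 0 ∧ IsInitial k n C) ∧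
    μ.reg 2 = 0) (Triple.assign fun μ h => ⟨⟨h.1.setReg (by omega), by simpa using h.2⟩,
      by simp [Expr.eval]⟩) ?_
  refine (Triple.nest regA_injective (B := n + 1) (fun C' μ => (Ctx n A μ ∧
    ∀ C, μ.arr 4 C ≠ 0 ↔ C < C' ∧ IsInitial k n C) ∧ μ.reg 2 = C') ?_ ?_ ?_).conseq (fun _ h => h)
    le_rfl fun μ h => h.1
  · exact fun C' μ h => by rw [h.1.1.reg]
  · intro C' μ j v h
    have := hA j
    exact ⟨⟨h.1.1.setReg (by omega), h.1.2⟩, by rw [Memory.reg_setReg_of_ne (by omega), h.2]⟩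
  · intro C' hC'
    have hev : ∀ μ, ((Ctx n A μ ∧ ∀ C, μ.arr 4 C ≠ 0 ↔ C < C' ∧ IsInitial k n C) ∧ μ.reg 2 = C') ∧
        (∀ i < k + k * c + M, μ.reg (regA i) = digit (n + 1) C' i) →
        ((Expr.initial k).eval μ ≠ 0 ↔ IsInitial k n C') := by
      rintro μ ⟨h₁, h₂⟩
      rw [Expr.initial, Expr.eval_all_ne_zero]
      refine forall₂_congr fun p hp => ?_
      rw [Expr.eval_equal_ne_zero]
      simp only [Expr.eval, h₁.1.1.reg]
      rw [h₂ p (by omega)]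
    refine Triple.seq (Q := fun μ => ((Ctx n A μ ∧ ∀ C, μ.arr 4 C ≠ 0 ↔ C < C' + 1 ∧
      IsInitial k n C) ∧ μ.reg 2 = C') ∧
        ∀ i < k + k * c + M, μ.reg (regA i) = digit (n + 1) C' i)
      (Triple.branch (Triple.store ?_) (Triple.skip ?_)) (Triple.incr ?_)
    · rintro μ ⟨h, he⟩
      refine ⟨⟨⟨h.1.1.1.setArr, fun C => ?_⟩, h.1.2⟩, h.2⟩
      rw [Memory.arr_setArr, if_pos rfl]
      simp only [Expr.eval, h.1.2]
      by_cases e : C = C'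
      · subst e
        simpa using (hev μ h).1 he
      · rw [Function.update_of_ne e, h.1.1.2 C]
        exact and_congr_left fun _ => by omega
    · rintro μ ⟨h, he⟩
      refine ⟨⟨⟨h.1.1.1, fun C => ?_⟩, h.1.2⟩, h.2⟩
      rw [h.1.1.2 C]
      by_cases e : C = C'
      · subst e
        exact ⟨fun h' => ⟨by omega, h'.2⟩, fun h' => absurd he ((hev μ h).2 h'.2)⟩
      · exact and_congr_left fun _ => by omega
    · rintro μ ⟨h, h'⟩
      refine ⟨⟨⟨h.1.1.setReg (by omega), h.1.2⟩, ?_⟩, fun i hi => ?_⟩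
      · rw [Memory.reg_setReg, if_pos rfl, h.2]
      · have := hA i
        rw [Memory.reg_setReg_of_ne (by omega), h' i hi]

theorem findFinal_triple (k c M : ℕ) : ∃ f : ℕ[X], ∀ n A vis,
    Triple (fun μ => Ctx n A μ ∧ μ.arr 4 = vis) (findFinal k c M) (f.eval n)
      (fun μ => μ.reg 0 ≤ 1 ∧ (μ.reg 0 ≠ 0 ↔ ∃ C < (n + 1) ^ (k + k * c + M), vis C ≠ 0 ∧
        ∀ p < k, digit (n + 1) C p = A 2 p)) := by
  refine ⟨4 + (nestTime (X + 1) (C ((Expr.markedFinal k).cost + 1) + 3 + 4) (k + k * c + M) + 6),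
    fun n A vis => ?_⟩
  simp only [eval_add, eval_nestTime, eval_X, eval_ofNat, eval_one, eval_C]
  have hA : ∀ j, 8 ≤ regA j := fun j => by unfold regA; omega
  let I : ℕ → Memory → Prop := fun C' μ => (Ctx n A μ ∧ μ.arr 4 = vis) ∧
    (μ.reg 6 ≠ 0 ↔ ∃ C < C', vis C ≠ 0 ∧ ∀ p < k, digit (n + 1) C p = A 2 p)
  refine Triple.seq (Q := fun μ => I 0 μ ∧ μ.reg 2 = 0) (Triple.seq (T := 2) (T' := 2)
    (Q := fun μ => I 0 μ) (Triple.assign ?_) (Triple.assign ?_)) (Triple.seq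
    (Q := I ((n + 1) ^ (k + k * c + M))) ((Triple.nest regA_injective (B := n + 1)
    (fun C' μ => I C' μ ∧ μ.reg 2 = C') ?_ ?_ ?_).conseq (fun _ h => h) le_rfl fun μ h => h.1)
    (Triple.assign ?_))
  · exact fun μ h => ⟨⟨h.1.setReg (by omega), h.2⟩, by simp [Expr.eval]⟩
  · exact fun μ h => ⟨⟨⟨h.1.1.setReg (by omega), h.1.2⟩, by simpa using h.2⟩, by simp [Expr.eval]⟩
  · exact fun C' μ h => by rw [h.1.1.1.reg]
  · intro C' μ j v h
    have := hA j
    exact ⟨⟨⟨h.1.1.1.setReg (by omega), h.1.1.2⟩,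
      by rw [Memory.reg_setReg_of_ne (by omega)]; exact h.1.2⟩,
      by rw [Memory.reg_setReg_of_ne (by omega), h.2]⟩
  · intro C' hC'
    have hev : ∀ μ, (I C' μ ∧ μ.reg 2 = C') ∧
        (∀ i < k + k * c + M, μ.reg (regA i) = digit (n + 1) C' i) →
        ((Expr.markedFinal k).eval μ ≠ 0 ↔
          vis C' ≠ 0 ∧ ∀ p < k, digit (n + 1) C' p = A 2 p) := by
      rintro μ ⟨⟨h₁, h₂⟩, h₃⟩
      rw [Expr.markedFinal, Expr.eval_and_ne_zero, Expr.eval_all_ne_zero]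
      refine and_congr (by simp [Expr.eval, h₁.1.2, h₂]) (forall₂_congr fun p hp => ?_)
      rw [Expr.eval_equal_ne_zero]
      simp only [Expr.eval, h₁.1.1.arr 2 (by omega)]
      rw [h₃ p (by omega)]
    refine Triple.seq (Q := fun μ => (I (C' + 1) μ ∧ μ.reg 2 = C') ∧
        ∀ i < k + k * c + M, μ.reg (regA i) = digit (n + 1) C' i)
      (Triple.branch (Triple.assign ?_) (Triple.skip ?_)) (Triple.incr ?_)
    · rintro μ ⟨h, he⟩
      refine ⟨⟨⟨⟨h.1.1.1.1.setReg (by omega), h.1.1.1.2⟩, ?_⟩,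
        by rw [Memory.reg_setReg_of_ne (by omega), h.1.2]⟩, fun i hi => ?_⟩
      · rw [Memory.reg_setReg, if_pos rfl]
        exact ⟨fun _ => ⟨C', by omega, (hev μ h).1 he⟩, fun _ => by simp [Expr.eval]⟩
      · have := hA i
        rw [Memory.reg_setReg_of_ne (by omega), h.2 i hi]
    · rintro μ ⟨h, he⟩
      refine ⟨⟨⟨h.1.1.1, h.1.1.2.trans ?_⟩, h.1.2⟩, h.2⟩
      constructor
      · exact fun ⟨C, hC, h'⟩ => ⟨C, by omega, h'⟩
      · rintro ⟨C, hC, h'⟩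
        refine ⟨C, lt_of_le_of_ne (by omega) ?_, h'⟩
        rintro rfl
        exact (hev μ h).2 h' he
    · rintro μ ⟨⟨h, h'⟩, h''⟩
      refine ⟨⟨⟨⟨h.1.1.setReg (by omega), h.1.2⟩,
        by rw [Memory.reg_setReg_of_ne (by omega)]; exact h.2⟩, ?_⟩, fun i hi => ?_⟩
      · rw [Memory.reg_setReg, if_pos rfl, h']
      · have := hA i
        rw [Memory.reg_setReg_of_ne (by omega), h'' i hi]
  · rintro μ ⟨-, h⟩
    rw [Memory.reg_setReg, if_pos rfl]
    -- The invariant only says whether register `6` is nonzero; the double negation bounds the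
    -- answer by `1`.
    refine ⟨by simp [Expr.eval, Expr.neg], ?_⟩
    rw [Expr.eval_neg_ne_zero, Expr.eval_neg_ne_zero, not_not]
    exact h

/-- The algorithm finds out whether the code of a final state can be reached. -/
theorem solver_spec (k c m M : ℕ) : ∃ f : ℕ[X], ∀ (n : ℕ) (A : ℕ → ℕ → ℕ) (μ : Memory),
    μ.reg 0 = n → (∀ a < 3, μ.arr a = A a) → (∀ C, μ.arr 4 C = 0) →
    ∃ (B : ℕ → ℕ → ℕ) (μ' : Memory) (T : ℕ), (∀ a < 3, B a = A a) ∧ (∀ u ≤ n, B 3 u = u * n) ∧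
      Runs (solver k c m M) μ μ' T ∧ T ≤ f.eval n ∧ μ'.reg 0 ≤ 1 ∧
      (μ'.reg 0 ≠ 0 → ∃ j C, ReachedIn (IsInitial k n) (CodeStep k c m M n B)
        ((n + 1) ^ (k + k * c + M)) j C ∧ ∀ p < k, digit (n + 1) C p = A 2 p) ∧
      (∀ j ≤ n, ∀ C, ReachedIn (IsInitial k n) (CodeStep k c m M n B)
        ((n + 1) ^ (k + k * c + M)) j C → (∀ p < k, digit (n + 1) C p = A 2 p) →
          μ'.reg 0 ≠ 0) := by
  obtain ⟨f₁, h₁⟩ := multiples_triple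
  obtain ⟨f₂, h₂⟩ := markInitial_triple k c M
  obtain ⟨f₃, h₃⟩ := sweeps_triple k c m M
  obtain ⟨f₄, h₄⟩ := findFinal_triple k c M
  refine ⟨f₁ + (f₂ + (f₃ + f₄)), fun n A μ hn hA hμ => ?_⟩
  obtain ⟨μ₁, T₁, r₁, t₁, e₁, e₁', e₁''⟩ := h₁ n μ.arr μ ⟨hn, rfl⟩
  have hB : ∀ a < 3, μ₁.arr a = A a := fun a ha => by rw [e₁' a (by omega), hA a ha]
  obtain ⟨μ₂, T₂, r₂, t₂, e₂⟩ := h₂ n μ₁.arr μ₁ ⟨⟨e₁, fun _ _ => rfl⟩, fun C => by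
    rw [e₁' 4 (by omega), hμ]⟩
  obtain ⟨μ₃, T₃, r₃, t₃, e₃⟩ := h₃ n μ₁.arr μ₂ e₂
  obtain ⟨μ₄, T₄, r₄, t₄, e₄, e₄'⟩ := h₄ n μ₁.arr (μ₃.arr 4) μ₃ ⟨e₃.ctx, rfl⟩
  rw [hB 2 (by omega)] at e₄'
  refine ⟨μ₁.arr, μ₄, _, hB, e₁'', r₁.seq (r₂.seq (r₃.seq r₄)), ?_, e₄, ?_, ?_⟩
  · simp only [eval_add]; omega
  · intro h
    obtain ⟨C, -, hv, hC⟩ := e₄'.1 h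
    obtain ⟨j, hj⟩ := e₃.marks.sound C hv
    exact ⟨j, C, hj, hC⟩
  · exact fun j hj C hC hp => e₄'.2 ⟨C, hC.lt, e₃.marks.old j hj C hC, hp⟩

end Search

/-! ### Decoding the input and correctness of the answer -/

open Classical in
theorem inputMemory_adj {n k : ℕ} (G : Digraph (Fin n)) (s t : Fin k → Fin n) (u : ℕ) (v : Fin n) :
    (inputMemory G s t).arr 0 (u * n + v) = if ∃ hu : u < n, G.Adj ⟨u, hu⟩ v then 1 else 0 := by
  simp only [inputMemory, if_true]
  refine if_congr ⟨?_, ?_⟩ rfl rfl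
  · rintro ⟨u', v', h, hadj⟩
    have hn : 0 < n := v.pos
    have h₁ : u = u' := by
      have := congrArg (· / n) h
      simpa [mul_comm _ n, Nat.mul_add_div hn, Nat.div_eq_of_lt] using this
    have h₂ : v = v' := by
      refine Fin.ext ?_
      rw [h₁] at h
      omega
    subst h₁ h₂
    exact ⟨u'.2, hadj⟩
  · rintro ⟨hu, hadj⟩
    exact ⟨⟨u, hu⟩, v, rfl, hadj⟩

/-- Every reached code describes disjoint partial paths. Dominance is not needed here: it matters
only for finding all linkages. -/
theorem solver_correct {k c m M n : ℕ} {G : Digraph (Fin n)} {s t : Fin k → Fin n}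
    {A : ℕ → ℕ → ℕ} (hA : ∀ a < 3, A a = (inputMemory G s t).arr a)
    (hA' : ∀ u ≤ n, A 3 u = u * n) {j C : ℕ}
    (h : ReachedIn (IsInitial k n) (CodeStep k c m M n A) ((n + 1) ^ (k + k * c + M)) j C) :
    Good k c m M G s (fun u v => A 0 (A 3 u + v)) (digit (n + 1) C) := by
  induction j generalizing C with
  | zero => exact good_init h.2
  | succ j ih =>
    obtain ⟨-, C', h', hst⟩ := h
    refine (ih h').step ?_ ?_ (digit_le C') hst
    · intro u v hu hv huv
      simp only [hA' u hu, hA 0 (by omega)] at huv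
      have := inputMemory_adj G s t u ⟨v, hv⟩
      simp only at this
      rw [this] at huv
      by_contra hcon
      refine huv (if_neg ?_)
      rintro ⟨hu, hadj⟩
      exact hcon ⟨hu, hv, hadj⟩
    · intro p
      rw [hA 1 (by omega)]
      simp [inputMemory]

end DisjointPaths

theorem theorem1p2 (d k : ℕ) (hd : 1 ≤ d) (hk : 1 ≤ k) :
    DisjointPaths.DisjointPathsInPolyTime k
      (fun _ G => DisjointPaths.IsPathDominant d G) := by
  open DisjointPaths in
  obtain ⟨c, m, M, hseq⟩ := exists_state_sequence d k hd
  obtain ⟨f, hf⟩ := solver_spec k c m M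
  refine ⟨solver k c m M, f, fun n G _ hG s t => ?_⟩
  obtain ⟨A, μ, T, hA, hA', hrun, hT, hle, hyes, hno⟩ := hf n (inputMemory G s t).arr
    (inputMemory G s t) rfl (fun _ _ => rfl) (fun C => by simp [inputMemory])
  have ht : ∀ p : Fin k, (inputMemory G s t).arr 2 p = t p := fun p => by simp [inputMemory]
  refine ⟨μ, T, hrun, hT, fun hL => ?_, fun hL => ?_⟩
  · have hE : ∀ u v : Fin n, (G.Adj u v → A 0 (A 3 u + v) = 1) ∧
        (¬ G.Adj u v → A 0 (A 3 u + v) = 0) := by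
      intro u v
      simp only [hA 0 (by omega), hA' u u.2.le, inputMemory_adj]
      exact ⟨fun h => if_pos ⟨u.2, h⟩, fun h => if_neg fun h' => h h'.2⟩
    -- Row `n` lies beyond the adjacency matrix, where the array is zero, so the missing vertex `n`
    -- has no out-neighbours.
    have hE' : ∀ v : Fin n, A 0 (A 3 n + v) = 0 := by
      intro v
      simp only [hA 0 (by omega), hA' n le_rfl, inputMemory_adj]
      exact if_neg fun h => lt_irrefl n h.1
    have hS : ∀ p : Fin k, A 1 p = s p := fun p => by simp [hA 1 (by omega), inputMemory]
    obtain ⟨T, σ, hTn, hσ, hinit, hstep, hfin⟩ := hseq n G s t (fun u v => A 0 (A 3 u + v)) (A 1)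
      hE hE' hS hG hL
    -- Only the first `k + k * c + M` entries of a state are encoded; `step_congr` shows that no
    -- others matter.
    choose C hC hCσ using fun i => exists_digits (σ i) (hσ i) (k + k * c + M)
    have hreach : ∀ i ≤ T, ReachedIn (IsInitial k n) (CodeStep k c m M n A)
        ((n + 1) ^ (k + k * c + M)) i (C i) := by
      intro i
      induction i with
      | zero =>
        exact fun _ => ⟨hC 0, fun p hp => by rw [hCσ 0 p (by omega), hinit p hp]⟩
      | succ i ih =>
        exact fun hi => ⟨hC _, C i, ih (by omega),
          (step_congr (hCσ i) (hCσ (i + 1))).2 (hstep i hi)⟩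
    have := hno T hTn (C T) (hreach T le_rfl) fun p hp => by
      rw [hCσ T p (by omega), ht ⟨p, hp⟩, hfin ⟨p, hp⟩]
    omega
  · by_contra hne
    obtain ⟨j, C, hC, hfin⟩ := hyes hne
    exact hL ((solver_correct hA hA' hC).hasLinkage fun p => (hfin p p.2).trans (ht p))
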